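/- Let $(\mathbf X,\mathcal B(\mathbf X))$ be a standard Borel space and $T_0\in\mathbb R$, $T_0<T_1\le+\infty$. Let $q$ be a conservative $Q$-function: for $x\in\mathbf X$ and $t\in[T_0,T_1[$, $q(x,t,\cdot)$ is a signed measure on $\mathbf X$ with $q(x,t,\mathbf X)=0$ and $0\le q(x,t,B\setminus\{x\})<\infty$ for all $B\in\mathcal B(\mathbf X)$, and $q(x,t,B)$ is measurable in $(x,t)$ for each $B\in\mathcal B(\mathbf X)$. Put $q(x,t):=q(x,t,\mathbf X\setminus\{x\})$ and assume that $\sup_{t\in[T_0,T_1[}q(x,t)<\infty$ for each $x\in\mathbf X$. A set $B\in\mathcal B(\mathbf X)$ is called $q$-bounded if $q(y,t)$ is bounded on $B\times[T_0,T_1[$. For $u\in[T_0,T_1[$, $t\in{]u,T_1[}$, $x\in\mathbf X$, $B\in\mathcal B(\mathbf X)$ define $$\bar P^{(0)}(u,x;t,B)=\mathbf I\{x\in B\}\,e^{-\int_u^t q(x,s)\,ds},$$ $$\bar P^{(n)}(u,x;t,B)=\int_u^t\int_{\mathbf X}e^{-\int_u^w q(x,\theta)\,d\theta}\,\bar P^{(n-1)}(w,y;t,B)\,q(x,w,dy\setminus\{x\})\,dw\quad(n\ge1),$$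 where $q(x,w,dy\setminus\{x\})$ denotes integration against the measure $A\mapsto q(x,w,A\setminus\{x\})$, and let $\bar P(u,x;t,B)=\sum_{n\ge0}\bar P^{(n)}(u,x;t,B)$. Let $\hat{\mathcal P}$ be the family of real-valued functions $P(u,x;t,B)$, defined for all $u\in[T_0,T_1[$, $t\in{]u,T_1[}$, $x\in\mathbf X$, $B\in\mathcal B(\mathbf X)$, which are measures in $B$ for fixed $u,x,t$ and are measurable in $t$ for fixed $u,x,B$. For $P\in\hat{\mathcal P}$ consider the integral forward equation $$P(u,x;t,B)=\mathbf I\{x\in B\}-\int_u^t\int_B q(y,w)\,P(u,x;w,dy)\,dw+\int_u^t\int_{\mathbf X}q(y,w,B\setminus\{y\})\,P(u,x;w,dy)\,dw,\qquad(\ast)$$ which is understood to include that both double integrals are finite. Then: (a) $\bar P\in\hat{\mathcal P}$, and $(\ast)$ holds for $P=\bar P$ for all $u\in[T_0,T_1[$, $x\in\mathbf X$, all $q$-bounded sets $B\in\mathcal B(\mathbf X)$ and all $t\in{]u,T_1[}$. (b) $\bar P$ is the minimal function in $\hat{\mathcal P}$ with the property in (a): if $P\in\hat{\mathcal P}$ satisfies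 $(\ast)$ for all $u\in[T_0,T_1[$, $x\in\mathbf X$, all $q$-bounded $B\in\mathcal B(\mathbf X)$ and all $t\in{]u,T_1[}$, then $\bar P(u,x;t,B)\le P(u,x;t,B)$ for all $u\in[T_0,T_1[$, $t\in{]u,T_1[}$, $x\in\mathbf X$, $B\in\mathcal B(\mathbf X)$. In addition, if $\bar P$ is regular, that is, $\bar P(u,x;t,\mathbf X)=1$ for all $u\in[T_0,T_1[$, $t\in{]u,T_1[}$, $x\in\mathbf X$, then $\bar P$ is the unique function in $\hat{\mathcal P}$ with values in $[0,1]$ that satisfies $(\ast)$ for all such $u,x,t$ and all $q$-bounded sets $B$. -/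

import Mathlib

open MeasureTheory Set
open scoped ENNReal

noncomputable section

namespace JumpMarkov

variable {X : Type*} [MeasurableSpace X]

/-- The half-open time interval `[a, T₁[`, where `T₁` may be `+∞`. -/
def timeIco (a : ℝ) (T₁ : EReal) : Set ℝ := {t | a ≤ t ∧ (t : EReal) < T₁}

/-- The open time interval `]a, T₁[`, where `T₁` may be `+∞`. -/
def timeIoo (a : ℝ) (T₁ : EReal) : Set ℝ := {t | a < t ∧ (t : EReal) < T₁}

/-- The set function `f` is a measure. Only its values on measurable sets matter. -/
def IsMeas (f : Set X → ℝ≥0∞) : Prop :=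
  f ∅ = 0 ∧ ∀ A : ℕ → Set X, (∀ i, MeasurableSet (A i)) → Pairwise (Function.onFun Disjoint A) →
    f (⋃ i, A i) = ∑' i, f (A i)

open Classical in
/-- The measure, as a bundled object, given by a set function `f` that is a measure; it is used to
write integrals `∫ g(y) f(dy)` (junk value `0` if `f` is not a measure). -/
def asMeasure (f : Set X → ℝ≥0∞) : Measure X :=
  if h : IsMeas f then Measure.ofMeasurable (fun B _ => f B) h.1 (fun A hA hd => h.2 A hA hd) else 0

theorem asMeasure_apply {f : Set X → ℝ≥0∞} (h : IsMeas f) {B : Set X} (hB : MeasurableSet B) :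
    asMeasure f B = f B := by
  rw [asMeasure, dif_pos h, Measure.ofMeasurable_apply B hB]

/-- `q(x,t,B)`, `x ∈ X`, `t ∈ [T₀,T₁[`, `B` measurable, is a Q-function. Signed measures are
real-valued, so `q(x,t,B \ {x}) < ∞` is automatic. -/
structure IsQFunction (T₀ : ℝ) (T₁ : EReal) (q : X → ℝ → SignedMeasure X) : Prop where
  total_nonpos : ∀ x, ∀ t ∈ timeIco T₀ T₁, q x t univ ≤ 0
  nonneg : ∀ x, ∀ t ∈ timeIco T₀ T₁, ∀ B, MeasurableSet B → 0 ≤ q x t (B \ {x})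
  measurable : ∀ B, MeasurableSet B →
    Measurable (fun p : X × timeIco T₀ T₁ => q p.1 (p.2 : ℝ) B)

/-- The Q-function `q` is conservative. -/
def IsConservative (T₀ : ℝ) (T₁ : EReal) (q : X → ℝ → SignedMeasure X) : Prop :=
  ∀ x, ∀ t ∈ timeIco T₀ T₁, q x t univ = 0

/-- The jump rate `q(x,t) = q(x,t,X \ {x})`. -/
def rate (q : X → ℝ → SignedMeasure X) (x : X) (t : ℝ) : ℝ := q x t (univ \ {x})

/-- The supremum of `q(x,t)` over `t ∈ [T₀,T₁[`, in `[0,∞]`. -/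
def rateSup (T₀ : ℝ) (T₁ : EReal) (q : X → ℝ → SignedMeasure X) (x : X) : ℝ≥0∞ :=
  ⨆ t ∈ timeIco T₀ T₁, ENNReal.ofReal (rate q x t)

/-- The measure `B ↦ q(x,t,B \ {x})`. -/
def jumpMeasure (q : X → ℝ → SignedMeasure X) (x : X) (t : ℝ) : Measure X :=
  asMeasure (fun B => ENNReal.ofReal (q x t (B \ {x})))

theorem jumpMeasure_apply [MeasurableSingletonClass X] {T₀ : ℝ} {T₁ : EReal}
    {q : X → ℝ → SignedMeasure X} (hq : IsQFunction T₀ T₁ q) (x : X) {t : ℝ}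
    (ht : t ∈ timeIco T₀ T₁) {B : Set X} (hB : MeasurableSet B) :
    jumpMeasure q x t B = ENNReal.ofReal (q x t (B \ {x})) := by
  refine asMeasure_apply ⟨by simp, fun A hA hd => ?_⟩ hB
  have hA' : ∀ i, MeasurableSet (A i \ {x}) := fun i => (hA i).diff (measurableSet_singleton x)
  have hd' : Pairwise (Function.onFun Disjoint fun i => A i \ {x}) := fun i j hij =>
    (hd hij).mono sdiff_subset sdiff_subset
  have hs := (q x t).m_iUnion hA' hd'
  rw [iUnion_sdiff, ← ENNReal.ofReal_tsum_of_nonneg (fun i => hq.nonneg x t ht _ (hA i)) hs.summable]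
  exact congrArg _ hs.tsum_eq.symm

/-- `exp(-∫_u^t q(x,s) ds)`. -/
def survival (q : X → ℝ → SignedMeasure X) (x : X) (u t : ℝ) : ℝ≥0∞ :=
  ENNReal.ofReal (Real.exp (-∫ s in u..t, rate q x s))

/-- The functions `P̄⁽ⁿ⁾(u,x;t,B)`. -/
def PbarN (q : X → ℝ → SignedMeasure X) : ℕ → ℝ → X → ℝ → Set X → ℝ≥0∞
  | 0, u, x, t, B => B.indicator (fun _ => 1) x * survival q x u t
  | n + 1, u, x, t, B =>
      ∫⁻ w in Ioo u t, ∫⁻ y, survival q x u w * PbarN q n w y t B ∂(jumpMeasure q x w)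

/-- Feller's transition function `P̄(u,x;t,B)`, the sum of the `P̄⁽ⁿ⁾(u,x;t,B)`. -/
def Pbar (q : X → ℝ → SignedMeasure X) (u : ℝ) (x : X) (t : ℝ) (B : Set X) : ℝ≥0∞ :=
  ∑' n, PbarN q n u x t B

/-- The class of finite functions `P(u,x;t,B)`, `u ∈ [T₀,T₁[`, `t ∈ ]u,T₁[`, that are measures in
`B` for fixed `u,x,t` and measurable in `t` for fixed `u,x,B`. -/
structure MemPHat (T₀ : ℝ) (T₁ : EReal) (P : ℝ → X → ℝ → Set X → ℝ≥0∞) : Prop where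
  isMeas : ∀ u ∈ timeIco T₀ T₁, ∀ x, ∀ t ∈ timeIoo u T₁, IsMeas (P u x t)
  finite : ∀ u ∈ timeIco T₀ T₁, ∀ x, ∀ t ∈ timeIoo u T₁, ∀ B, MeasurableSet B → P u x t B < ∞
  measurable : ∀ u ∈ timeIco T₀ T₁, ∀ x, ∀ B, MeasurableSet B →
    Measurable (fun t : timeIoo u T₁ => P u x (t : ℝ) B)

/-- `B` is `q`-bounded: `q(x,t)` is bounded on `B × [T₀,T₁[`. -/
def IsQBounded (T₀ : ℝ) (T₁ : EReal) (q : X → ℝ → SignedMeasure X) (B : Set X) : Prop :=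
  ∃ K : ℝ, ∀ y ∈ B, ∀ t ∈ timeIco T₀ T₁, rate q y t ≤ K

/-- `∫_u^t ∫_B q(y,w) P(u,x;w,dy) dw`, in `[0,∞]`. -/
def outflow (q : X → ℝ → SignedMeasure X) (P : ℝ → X → ℝ → Set X → ℝ≥0∞)
    (u : ℝ) (x : X) (t : ℝ) (B : Set X) : ℝ≥0∞ :=
  ∫⁻ w in Ioo u t, ∫⁻ y in B, ENNReal.ofReal (rate q y w) ∂(asMeasure (P u x w))

/-- `∫_u^t ∫_X q(y,w,B \ {y}) P(u,x;w,dy) dw`, in `[0,∞]`. -/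
def inflow (q : X → ℝ → SignedMeasure X) (P : ℝ → X → ℝ → Set X → ℝ≥0∞)
    (u : ℝ) (x : X) (t : ℝ) (B : Set X) : ℝ≥0∞ :=
  ∫⁻ w in Ioo u t, ∫⁻ y, ENNReal.ofReal (q y w (B \ {y})) ∂(asMeasure (P u x w))

/-- For all `u ∈ [T₀,T₁[`, `x ∈ X`, all `q`-bounded measurable `B` and all `t ∈ ]u,T₁[`, the
integral form of Kolmogorov's forward equation holds for `P`: both integrals are finite (so that
the right-hand side is a well-defined real number) and the two sides are equal. -/
def SatisfiesFKE (T₀ : ℝ) (T₁ : EReal) (q : X → ℝ → SignedMeasure X)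
    (P : ℝ → X → ℝ → Set X → ℝ≥0∞) : Prop :=
  ∀ u ∈ timeIco T₀ T₁, ∀ x, ∀ B, MeasurableSet B → IsQBounded T₀ T₁ q B → ∀ t ∈ timeIoo u T₁,
    outflow q P u x t B < ∞ ∧ inflow q P u x t B < ∞ ∧
    (P u x t B).toReal =
      B.indicator (fun _ => (1 : ℝ)) x - (outflow q P u x t B).toReal + (inflow q P u x t B).toReal

/-- The values of `P` lie in `[0,1]`. -/
def ValuesLeOne (T₀ : ℝ) (T₁ : EReal) (P : ℝ → X → ℝ → Set X → ℝ≥0∞) : Prop :=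
  ∀ u ∈ timeIco T₀ T₁, ∀ x, ∀ t ∈ timeIoo u T₁, ∀ B, MeasurableSet B → P u x t B ≤ 1

/-- `P` is regular: `P(u,x;t,X) = 1` on the whole domain. -/
def IsRegular (T₀ : ℝ) (T₁ : EReal) (P : ℝ → X → ℝ → Set X → ℝ≥0∞) : Prop :=
  ∀ u ∈ timeIco T₀ T₁, ∀ x, ∀ t ∈ timeIoo u T₁, P u x t univ = 1

end JumpMarkov

end

noncomputable section

/-! `PbarN q n u x t` is the law at time t of a jump process on the event of exactly n jumps; its
definition conditions on the first jump. Interchanging integrals gives an equivalent recursion on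
the last jump (`lintegral_iterKernel_succ_forward`): generation n + 1 consists of the particles born
by jumps of generation n that have survived since. Survival probability and integrated killing
density add up to 1, so each generation obeys a balance: alive plus killed equals born. Summed over
n, these balances are the forward equation (`fellerKernel_forward`).

For minimality, a solution P is an evolution of measures killed at rate q whose source is its own
jump flux. Variation of constants (`evolution_apply_univ`) puts it in a form without subtraction,
monotone in the flux. Comparison with the last-jump recursion shows by induction that all partial
sums of P̄ lie below P (`fellerKernel_le`).

The equation is given only on q-bounded sets, so X has to be exhausted by measurable q-bounded sets.
The sets where the supremum of the rate over time exceeds n are projections of Borel sets, hence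
analytic, and have empty intersection. Novikov separation encloses them in Borel sets with empty
intersection, whose complements yield the exhaustion. Under regularity P̄ already has total mass 1,
which leaves a larger P with values at most 1 no excess. -/

namespace JumpMarkov

open ProbabilityTheory
open scoped ProbabilityTheory

/-! ### Novikov separation of analytic sets -/

section
/-- The members of a sequence of sets have Borel supersets with empty intersection. -/
def MeasurablySeparableSeq {α : Type*} [MeasurableSpace α] (S : ℕ → Set α) : Prop :=
  ∃ B : ℕ → Set α, (∀ n, MeasurableSet (B n)) ∧ (∀ n, S n ⊆ B n) ∧ ⋂ n, B n = ∅

/-- A point in all the combined sets lies in some `B i m`, hence in every `B i n`, which is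
impossible. By contraposition, nonseparability descends to one of the pieces. -/
theorem MeasurablySeparableSeq.of_iUnion {α : Type*} [MeasurableSpace α] {S : ℕ → Set α}
    {T : ℕ → ℕ → Set α} (m : ℕ) (hm : S m ⊆ ⋃ i, T i m) (hne : ∀ i n, n ≠ m → S n ⊆ T i n)
    (hT : ∀ i, MeasurablySeparableSeq (T i)) : MeasurablySeparableSeq S := by
  choose B hB hTB hE using hT
  refine ⟨fun n => if n = m then ⋃ i, B i n else ⋂ i, B i n, fun n => ?_, fun n => ?_, ?_⟩
  · dsimp only
    split_ifs
    · exact .iUnion fun i => hB i n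
    · exact .iInter fun i => hB i n
  · dsimp only
    split_ifs with h
    · subst h
      exact hm.trans (iUnion_mono fun i => hTB i n)
    · exact subset_iInter fun i => (hne i n h).trans (hTB i n)
  · refine eq_empty_of_forall_notMem fun x hx => ?_
    rw [mem_iInter] at hx
    have hxm := hx m
    simp only [if_true, mem_iUnion] at hxm
    obtain ⟨i, hi⟩ := hxm
    have : x ∈ ⋂ n, B i n := by
      refine mem_iInter.2 fun n => ?_
      by_cases h : n = m
      · exact h ▸ hi
      · have := hx n
        simp only [h, if_false, mem_iInter] at this
        exact this i
    rw [hE i] at this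
    exact this

open PiNat in
/-- **Novikov separation** for continuous images of the Baire space. -/
theorem measurablySeparableSeq_range {α : Type*} [TopologicalSpace α] [T2Space α]
    [MeasurableSpace α] [OpensMeasurableSpace α] {f : ℕ → (ℕ → ℕ) → α}
    (hf : ∀ n, Continuous (f n)) (h : ⋂ n, range (f n) = ∅) :
    MeasurablySeparableSeq fun n => range (f n) := by
  by_contra hsep
  -- A single z codes a sequence of points of the Baire space: `g n` reads only the coordinates
  -- `Nat.pair n m`.
  let g : ℕ → (ℕ → ℕ) → α := fun n z => f n fun m => z (Nat.pair n m)
  have hg : ∀ n, Continuous (g n) := fun n =>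
    (hf n).comp (continuous_pi fun m => continuous_apply _)
  let Q : (ℕ → ℕ) → ℕ → ℕ → Set α := fun z k n => g n '' cylinder z k
  have step : ∀ k z, ¬ MeasurablySeparableSeq (Q z k) →
      ∃ i, ¬ MeasurablySeparableSeq (Q (Function.update z k i) (k + 1)) := by
    intro k z
    contrapose!
    intro H
    -- Digit k is read only by the map of index `k.unpair.1`; for every other index, fixing this
    -- digit leaves the image unchanged.
    refine .of_iUnion (k.unpair).1 ?_ (fun i n hn => ?_) H
    · simp only [Q]
      rw [← image_iUnion]
      exact image_mono (iUnion_cylinder_update z k).superset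
    · rintro _ ⟨y, hy, rfl⟩
      refine ⟨Function.update y k i, ?_, ?_⟩
      · rw [mem_cylinder_iff] at hy ⊢
        intro j hj
        by_cases hjk : j = k
        · simp [hjk]
        · simp only [Function.update_of_ne hjk]
          exact hy j (by omega)
      · simp only [g]
        congr 1
        ext m
        refine Function.update_of_ne (fun h => hn ?_) _ _
        rw [← h, Nat.unpair_pair]
  have h0 : ¬ MeasurablySeparableSeq (Q 0 0) := by
    have : Q 0 0 = fun n => range (f n) := by
      ext1 n
      simp only [Q, cylinder_zero, image_univ]
      ext a
      constructor
      · rintro ⟨z, rfl⟩; exact ⟨_, rfl⟩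
      · rintro ⟨y, rfl⟩; exact ⟨fun j => y (j.unpair).2, by simp [g]⟩
    rwa [this]
  -- Successive choices of digits keep every initial cylinder nonseparable and converge to one point
  -- z.
  choose! c hc using step
  let p : ℕ → ℕ → ℕ := fun k =>
    Nat.rec (0 : ℕ → ℕ) (fun j z => Function.update z j (c j z)) k
  have hp : ∀ k, ¬ MeasurablySeparableSeq (Q (p k) k) := by
    intro k
    induction k with
    | zero => exact h0
    | succ k ih => exact hc k (p k) ih
  have hstat : ∀ m n, m + 1 ≤ n → p n m = p (m + 1) m := by
    intro m
    refine Nat.le_induction rfl fun n hmn ih => ?_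
    rw [← ih]
    exact Function.update_of_ne (by omega) _ _
  let z : ℕ → ℕ := fun m => p (m + 1) m
  have hz : ∀ k, ¬ MeasurablySeparableSeq (Q z k) := by
    intro k
    convert hp k using 2
    simp only [Q]
    ext1 n
    congr 1
    rw [← mem_cylinder_iff_eq, mem_cylinder_iff]
    exact fun i hi => (hstat i k hi).symm
  -- The points `g n z` cannot all coincide, as the ranges have empty intersection. By continuity,
  -- disjoint neighbourhoods of two of them separate the images of a small cylinder, against `hz`.
  obtain ⟨i, hi⟩ : ∃ i, g 0 z ≠ g i z := by
    by_contra! H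
    have : g 0 z ∈ ⋂ n, range (f n) := mem_iInter.2 fun n => ⟨_, (H n).symm⟩
    rw [h] at this
    exact this
  obtain ⟨u, v, hu, hv, hzu, hzv, huv⟩ := t2_separation hi
  let : MetricSpace (ℕ → ℕ) := metricSpaceNatNat
  obtain ⟨ε, hε, hball⟩ : ∃ ε > 0, Metric.ball z ε ⊆ g 0 ⁻¹' u ∩ g i ⁻¹' v :=
    Metric.mem_nhds_iff.1 (Filter.inter_mem ((hg 0).continuousAt.preimage_mem_nhds
      (hu.mem_nhds hzu)) ((hg i).continuousAt.preimage_mem_nhds (hv.mem_nhds hzv)))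
  obtain ⟨k, hk⟩ : ∃ k : ℕ, (1 / 2 : ℝ) ^ k < ε := exists_pow_lt_of_lt_one hε (by norm_num)
  have hcyl : cylinder z k ⊆ g 0 ⁻¹' u ∩ g i ⁻¹' v := fun y hy =>
    hball ((mem_cylinder_iff_dist_le.1 hy).trans_lt hk)
  have hi0 : i ≠ 0 := fun h => hi (by rw [h])
  refine hz k ⟨fun n => if n = 0 then u else if n = i then v else univ, fun n => ?_, fun n => ?_,
    ?_⟩
  · dsimp only
    split_ifs
    exacts [hu.measurableSet, hv.measurableSet, .univ]
  · dsimp only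
    split_ifs with h1 h2
    · subst h1
      exact image_subset_iff.2 fun y hy => (hcyl hy).1
    · subst h2
      exact image_subset_iff.2 fun y hy => (hcyl hy).2
    · exact subset_univ _
  · refine eq_empty_of_forall_notMem fun x hx => ?_
    rw [mem_iInter] at hx
    have h1 := hx 0
    have h2 := hx i
    simp only [if_true, hi0, if_false] at h1 h2
    exact disjoint_left.1 huv h1 h2

/-- **Novikov separation theorem**: analytic sets with empty intersection have Borel supersets with
empty intersection. -/
theorem measurablySeparableSeq_of_analyticSet {α : Type*} [TopologicalSpace α] [T2Space α]
    [MeasurableSpace α] [OpensMeasurableSpace α] {A : ℕ → Set α} (hA : ∀ n, AnalyticSet (A n))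
    (h : ⋂ n, A n = ∅) : MeasurablySeparableSeq A := by
  by_cases hne : ∃ m, A m = ∅
  · obtain ⟨m, hm⟩ := hne
    refine ⟨fun n => if n = m then ∅ else univ, fun n => ?_, fun n => ?_, ?_⟩
    · dsimp only
      split_ifs
      exacts [.empty, .univ]
    · dsimp only
      split_ifs with h1
      · rw [h1, hm]
      · exact subset_univ _
    · exact subset_empty_iff.1 ((iInter_subset _ m).trans (by simp))
  · have H : ∀ n, ∃ f : (ℕ → ℕ) → α, Continuous f ∧ range f = A n := by
      intro n
      have := hA n
      rw [AnalyticSet] at this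
      exact this.resolve_left fun h => hne ⟨n, h⟩
    choose f hf hfA using H
    have := measurablySeparableSeq_range hf (by simpa only [hfA] using h)
    simpa only [hfA] using this

end

/-! ### Exponentials of integrated rates -/

section
-- The rate is merely measurable in time, so the integrand is a derivative only almost everywhere.
-- Boundedness makes the primitive Lipschitz, hence its exponential absolutely continuous, which
-- suffices for the fundamental theorem.
theorem integral_mul_exp_integral {r : ℝ → ℝ} {u t K : ℝ} (c : ℝ)
    (hr : Measurable r) (hK : ∀ w, ‖r w‖ ≤ K) :
    ∫ w in u..t, c * r w * Real.exp (c * ∫ s in u..w, r s) =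
      Real.exp (c * ∫ s in u..t, r s) - 1 := by
  have hK0 : 0 ≤ K := (norm_nonneg _).trans (hK 0)
  have hint : ∀ a b, IntervalIntegrable r volume a b := fun a b =>
    intervalIntegrable_const.mono_fun (f := fun _ => K) hr.aestronglyMeasurable
      (.of_forall fun w => by simpa [abs_of_nonneg hK0] using hK w)
  set H : ℝ → ℝ := fun w => c * ∫ s in u..w, r s with hH
  have hlip : LipschitzWith ⟨|c| * K, by positivity⟩ H := by
    refine LipschitzWith.of_dist_le_mul fun v w => ?_
    rw [Real.dist_eq, hH, ← mul_sub, intervalIntegral.integral_interval_sub_left (hint _ _)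
      (hint _ _), abs_mul]
    have := intervalIntegral.norm_integral_le_of_norm_le_const (a := w) (b := v) (f := r) (C := K)
      (fun x _ => hK x)
    rw [Real.norm_eq_abs] at this
    calc |c| * |∫ x in w..v, r x| ≤ |c| * (K * |v - w|) := by gcongr
      _ = _ := by rw [Real.dist_eq, ← mul_assoc]; rfl
  obtain ⟨a, b, hab⟩ : ∃ a b, MapsTo H (uIcc u t) (Icc a b) := by
    obtain ⟨C, hC⟩ := isCompact_uIcc.exists_bound_of_continuousOn
      (s := uIcc u t) hlip.continuous.continuousOn
    exact ⟨-C, C, fun x hx => abs_le.1 (hC x hx)⟩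
  obtain ⟨L, hL⟩ := (Real.contDiff_exp (n := 1)).contDiffOn.exists_lipschitzOnWith (by decide)
    (convex_Icc a b) isCompact_Icc
  have hac := (hL.comp hlip.lipschitzOnWith hab).absolutelyContinuousOnInterval
  have hftc := hac.integral_deriv_eq_sub
  have h0 : H u = 0 := by simp [hH]
  simp only [Function.comp, h0, Real.exp_zero] at hftc
  rw [← hftc]
  refine intervalIntegral.integral_congr_ae ?_
  filter_upwards [(hint u t).ae_hasDerivAt_integral] with w hw hwut
  have := ((hw (uIoc_subset_uIcc hwut) u left_mem_uIcc).const_mul c).exp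
  exact (this.deriv.trans (by ring)).symm

theorem lintegral_Ioo_eq_ofReal_integral {f : ℝ → ℝ} {u t : ℝ} (hut : u ≤ t)
    (hf0 : ∀ w, 0 ≤ f w) (hi : IntervalIntegrable f volume u t) :
    ∫⁻ w in Ioo u t, ENNReal.ofReal (f w) = ENNReal.ofReal (∫ w in u..t, f w) := by
  rw [intervalIntegral.integral_of_le hut, ofReal_integral_eq_lintegral_ofReal
    ((intervalIntegrable_iff_integrableOn_Ioc_of_le hut).1 hi) (.of_forall hf0),
    setLIntegral_congr Ioo_ae_eq_Ioc]

variable {r : ℝ → ℝ} {u t K : ℝ}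

theorem exp_integral_add_lintegral_left (hut : u ≤ t) (hr : Measurable r) (hr0 : ∀ w, 0 ≤ r w)
    (hK : ∀ w, r w ≤ K) :
    ENNReal.ofReal (Real.exp (-∫ s in u..t, r s)) + ∫⁻ w in Ioo u t,
      ENNReal.ofReal (r w) * ENNReal.ofReal (Real.exp (-∫ s in u..w, r s)) = 1 := by
  have hK' : ∀ w, ‖r w‖ ≤ K := fun w => by rw [Real.norm_of_nonneg (hr0 w)]; exact hK w
  have hint : ∀ a b, IntervalIntegrable r volume a b := fun a b =>
    intervalIntegrable_const.mono_fun (f := fun _ => K) hr.aestronglyMeasurable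
      (.of_forall fun w => (hK' w).trans (le_abs_self _))
  have hcont : Continuous fun w => ∫ s in u..w, r s :=
    intervalIntegral.continuous_primitive hint u
  have key := integral_mul_exp_integral (u := u) (t := t) (-1) hr hK'
  simp only [neg_mul, one_mul] at key
  rw [intervalIntegral.integral_neg] at key
  have hle : Real.exp (-∫ s in u..t, r s) ≤ 1 := by
    rw [Real.exp_le_one_iff]
    simpa using intervalIntegral.integral_nonneg hut fun w _ => hr0 w
  simp_rw [← ENNReal.ofReal_mul (hr0 _)]
  rw [lintegral_Ioo_eq_ofReal_integral hut
    (fun w => mul_nonneg (hr0 w) (Real.exp_nonneg _))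
    ((hint u t).mul_continuousOn (by fun_prop)),
    show (∫ w in u..t, r w * Real.exp (-∫ s in u..w, r s)) =
      1 - Real.exp (-∫ s in u..t, r s) by linarith,
    ← ENNReal.ofReal_add (Real.exp_nonneg _) (by linarith)]
  simp

/-- Here the lower endpoint varies. Factoring out the exponential over the whole interval leaves the
case `c = 1`; this version drives the variation of constants. -/
theorem exp_integral_add_lintegral_right (hut : u ≤ t) (hr : Measurable r) (hr0 : ∀ w, 0 ≤ r w)
    (hK : ∀ w, r w ≤ K) :
    ENNReal.ofReal (Real.exp (-∫ s in u..t, r s)) + ∫⁻ w in Ioo u t,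
      ENNReal.ofReal (r w) * ENNReal.ofReal (Real.exp (-∫ s in w..t, r s)) = 1 := by
  have hK' : ∀ w, ‖r w‖ ≤ K := fun w => by rw [Real.norm_of_nonneg (hr0 w)]; exact hK w
  have hint : ∀ a b, IntervalIntegrable r volume a b := fun a b =>
    intervalIntegrable_const.mono_fun (f := fun _ => K) hr.aestronglyMeasurable
      (.of_forall fun w => (hK' w).trans (le_abs_self _))
  have hcont : Continuous fun w => ∫ s in u..w, r s :=
    intervalIntegral.continuous_primitive hint u
  have key := integral_mul_exp_integral (u := u) (t := t) 1 hr hK'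
  simp only [one_mul] at key
  have hle : Real.exp (-∫ s in u..t, r s) ≤ 1 := by
    rw [Real.exp_le_one_iff]
    simpa using intervalIntegral.integral_nonneg hut fun w _ => hr0 w
  have hsplit : ∀ w, Real.exp (-∫ s in w..t, r s) =
      Real.exp (-∫ s in u..t, r s) * Real.exp (∫ s in u..w, r s) := fun w => by
    rw [← Real.exp_add, ← intervalIntegral.integral_add_adjacent_intervals (hint u w) (hint w t)]
    congr 1
    ring
  have hcongr : ∫⁻ w in Ioo u t,
      ENNReal.ofReal (r w) * ENNReal.ofReal (Real.exp (-∫ s in w..t, r s)) =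
      ∫⁻ w in Ioo u t, ENNReal.ofReal
        (r w * (Real.exp (-∫ s in u..t, r s) * Real.exp (∫ s in u..w, r s))) :=
    lintegral_congr fun w => by rw [← ENNReal.ofReal_mul (hr0 w), hsplit w]
  have hval : (∫ w in u..t, r w * (Real.exp (-∫ s in u..t, r s) * Real.exp (∫ s in u..w, r s))) =
      1 - Real.exp (-∫ s in u..t, r s) := by
    rw [intervalIntegral.integral_congr fun w _ => mul_left_comm (r w) _ _,
      intervalIntegral.integral_const_mul, key, mul_sub, ← Real.exp_add]
    simp
  rw [hcongr, lintegral_Ioo_eq_ofReal_integral hut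
    (fun w => mul_nonneg (hr0 w) (by positivity))
    ((hint u t).mul_continuousOn (by fun_prop)), hval,
    ← ENNReal.ofReal_add (Real.exp_nonneg _) (by linarith)]
  simp

end

/-! ### Kernels and joint measurability of Q-functions -/

section
/-- A kernel whose measures are all finite is s-finite, without a uniform bound on their masses. -/
theorem isSFiniteKernel_of_forall_isFiniteMeasure {α β : Type*} [MeasurableSpace α]
    [MeasurableSpace β] (κ : Kernel α β) (h : ∀ a, IsFiniteMeasure (κ a)) :
    IsSFiniteKernel κ := by
  have hm : Measurable fun a => κ a univ := κ.measurable_coe .univ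
  let η : Kernel α β :=
    { toFun := fun a => (κ a univ)⁻¹ • κ a
      measurable' := Measure.measurable_of_measurable_coe _ fun s hs => by
        simpa using! hm.inv.mul (κ.measurable_coe hs) }
  have hη : ∀ a, η a = (κ a univ)⁻¹ • κ a := fun _ => rfl
  have : IsFiniteKernel η :=
    ⟨1, by simp, fun a => by simp [hη, ENNReal.inv_mul_le_one]⟩
  have hf : Measurable (Function.uncurry fun a (_ : β) => κ a univ) := hm.comp measurable_fst
  have hκ : κ = η.withDensity fun a _ => κ a univ := by
    ext a s hs
    rw [Kernel.withDensity_apply' _ hf, hη]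
    simp only [lintegral_const, Measure.smul_apply, Measure.restrict_apply, MeasurableSet.univ,
      univ_inter, smul_eq_mul, Measure.restrict_smul]
    -- For a zero measure the inverse mass is ∞ and does not cancel, but both sides vanish.
    by_cases h0 : κ a univ = 0
    · simp [Measure.measure_univ_eq_zero.1 h0]
    · rw [← mul_assoc, ENNReal.mul_inv_cancel h0 (measure_ne_top _ _), one_mul]
  rw [hκ]
  exact Kernel.IsSFiniteKernel.withDensity η fun a _ => measure_ne_top (κ a) univ

variable {X : Type*} [MeasurableSpace X]

/-- A Q-function on all of `ℝ`, with bounded rates at each point. -/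
structure IsGlobalQFunction (q : X → ℝ → SignedMeasure X) : Prop where
  isQFunction : ∀ T₀, IsQFunction T₀ ⊤ q
  measurable : ∀ B, MeasurableSet B → Measurable fun p : X × ℝ => q p.1 p.2 B
  bounded : ∀ x, ∃ K, ∀ t, rate q x t ≤ K

namespace IsGlobalQFunction

variable {q : X → ℝ → SignedMeasure X}

theorem nonneg (hq : IsGlobalQFunction q) (x : X) (t : ℝ) {B : Set X} (hB : MeasurableSet B) :
    0 ≤ q x t (B \ {x}) :=
  (hq.isQFunction t).nonneg x t ⟨le_rfl, EReal.coe_lt_top t⟩ B hB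

theorem rate_nonneg (hq : IsGlobalQFunction q) (x : X) (t : ℝ) : 0 ≤ rate q x t :=
  hq.nonneg x t .univ

theorem jumpMeasure_apply [MeasurableSingletonClass X] (hq : IsGlobalQFunction q) (x : X) (t : ℝ)
    {B : Set X} (hB : MeasurableSet B) :
    jumpMeasure q x t B = ENNReal.ofReal (q x t (B \ {x})) :=
  JumpMarkov.jumpMeasure_apply (hq.isQFunction t) x ⟨le_rfl, EReal.coe_lt_top t⟩ hB

theorem jumpMeasure_univ [MeasurableSingletonClass X] (hq : IsGlobalQFunction q) (x : X) (t : ℝ) :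
    jumpMeasure q x t univ = ENNReal.ofReal (rate q x t) :=
  hq.jumpMeasure_apply x t .univ

/-- Measurability is assumed for fixed B, whereas the jump measure evaluates `B \ {x}`, which moves
with x. Sections of a product set cover this case, since the diagonal is measurable in a standard
Borel space. -/
theorem measurable_section (hq : IsGlobalQFunction q) {C : Set (X × X)} (hC : MeasurableSet C) :
    Measurable fun p : X × ℝ => q p.1 p.2 (Prod.mk p.1 ⁻¹' C) := by
  induction C, hC using MeasurableSpace.induction_on_inter generateFrom_prod.symm
    isPiSystem_prod with
  | empty => simp
  | basic C hC =>
    obtain ⟨s, hs, t, ht, rfl⟩ := hC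
    have : (fun p : X × ℝ => q p.1 p.2 (Prod.mk p.1 ⁻¹' (s ×ˢ t))) =
        (Prod.fst ⁻¹' s).indicator fun p => q p.1 p.2 t := by
      ext p
      by_cases hp : p.1 ∈ s <;> simp [hp]
    rw [this]
    exact (hq.measurable t ht).indicator (measurable_fst hs)
  | compl C hC ih =>
    have : (fun p : X × ℝ => q p.1 p.2 (Prod.mk p.1 ⁻¹' Cᶜ)) =
        fun p => q p.1 p.2 univ - q p.1 p.2 (Prod.mk p.1 ⁻¹' C) := by
      ext p
      have := (q p.1 p.2).of_add_of_sdiff (measurable_prodMk_left (x := p.1) hC) .univ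
        (subset_univ _)
      rw [preimage_compl, compl_eq_univ_sdiff, ← this]
      ring
    rw [this]
    exact (hq.measurable _ .univ).sub ih
  | iUnion C hd hC ih =>
    have hs : ∀ p : X × ℝ, HasSum (fun i => q p.1 p.2 (Prod.mk p.1 ⁻¹' C i))
        (q p.1 p.2 (Prod.mk p.1 ⁻¹' ⋃ i, C i)) := fun p => by
      rw [preimage_iUnion]
      exact (q p.1 p.2).m_iUnion (fun i => measurable_prodMk_left (hC i))
        fun i j hij => (hd hij).preimage _
    refine measurable_of_tendsto_metrizable
      (f := fun n (p : X × ℝ) => ∑ i ∈ Finset.range n, q p.1 p.2 (Prod.mk p.1 ⁻¹' C i))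
      (fun n => Finset.measurable_fun_sum _ fun i _ => ih i) ?_
    exact tendsto_pi_nhds.2 fun p => (hs p).tendsto_sum_nat

variable [StandardBorelSpace X]

theorem measurable_sdiff_singleton (hq : IsGlobalQFunction q) {B : Set X} (hB : MeasurableSet B) :
    Measurable fun p : X × ℝ => q p.1 p.2 (B \ {p.1}) := by
  have hC : MeasurableSet (Prod.snd ⁻¹' B \ diagonal X) :=
    (measurable_snd hB).diff measurableSet_diagonal
  convert hq.measurable_section hC using 4 with p
  ext y
  simp [eq_comm]

theorem measurable_rate (hq : IsGlobalQFunction q) :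
    Measurable fun p : X × ℝ => rate q p.1 p.2 :=
  hq.measurable_sdiff_singleton .univ

/-- The measures `q(x,t,· \ {x})` as a kernel. -/
def jumpKernel (hq : IsGlobalQFunction q) : Kernel (X × ℝ) X where
  toFun p := jumpMeasure q p.1 p.2
  measurable' := Measure.measurable_of_measurable_coe _ fun B hB => by
    simp_rw [fun p : X × ℝ => hq.jumpMeasure_apply p.1 p.2 hB]
    exact (hq.measurable_sdiff_singleton hB).ennreal_ofReal

@[simp]
theorem jumpKernel_apply (hq : IsGlobalQFunction q) (p : X × ℝ) :
    hq.jumpKernel p = jumpMeasure q p.1 p.2 := rfl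

instance (hq : IsGlobalQFunction q) : IsSFiniteKernel hq.jumpKernel :=
  isSFiniteKernel_of_forall_isFiniteMeasure _ fun p => ⟨by
    rw [jumpKernel_apply, hq.jumpMeasure_univ]
    exact ENNReal.ofReal_lt_top⟩

theorem measurable_rate_right (hq : IsGlobalQFunction q) (x : X) : Measurable (rate q x) :=
  hq.measurable_rate.comp measurable_prodMk_left

theorem measurable_survival (hq : IsGlobalQFunction q) :
    Measurable fun p : ℝ × X × ℝ => survival q p.2.1 p.1 p.2.2 := by
  have h : ∀ f g : ℝ × X × ℝ → ℝ, Measurable f → Measurable g →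
      Measurable fun p => ∫ s in Ioc (f p) (g p), rate q p.2.1 s := by
    intro f g hf hg
    have : ∀ p, ∫ s in Ioc (f p) (g p), rate q p.2.1 s =
        ∫ s, {z : (ℝ × X × ℝ) × ℝ | z.2 ∈ Ioc (f z.1) (g z.1)}.indicator
          (fun z => rate q z.1.2.1 z.2) (p, s) := fun p => by
      rw [← integral_indicator measurableSet_Ioc]
      rfl
    simp_rw [this]
    refine (StronglyMeasurable.integral_prod_right (ν := volume) ?_).measurable
    refine Measurable.stronglyMeasurable (Measurable.indicator ?_ ?_)
    · exact hq.measurable_rate.comp (by fun_prop : Measurable fun z : (ℝ × X × ℝ) × ℝ =>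
        (z.1.2.1, z.2))
    · exact (measurableSet_lt (hf.comp measurable_fst) measurable_snd).inter
        (measurableSet_le measurable_snd (hg.comp measurable_fst))
  simp only [survival, intervalIntegral]
  exact (((h _ _ measurable_fst (by fun_prop)).sub
    (h _ _ (by fun_prop) measurable_fst)).neg.exp).ennreal_ofReal

theorem survival_add_lintegral_left (hq : IsGlobalQFunction q) (x : X) {u t : ℝ} (hut : u ≤ t) :
    survival q x u t +
      ∫⁻ w in Ioo u t, ENNReal.ofReal (rate q x w) * survival q x u w = 1 :=
  have ⟨_, hK⟩ := hq.bounded x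
  exp_integral_add_lintegral_left hut (hq.measurable_rate_right x) (hq.rate_nonneg x) hK

theorem survival_add_lintegral_right (hq : IsGlobalQFunction q) (x : X) {u t : ℝ} (hut : u ≤ t) :
    survival q x u t +
      ∫⁻ w in Ioo u t, ENNReal.ofReal (rate q x w) * survival q x w t = 1 :=
  have ⟨_, hK⟩ := hq.bounded x
  exp_integral_add_lintegral_right hut (hq.measurable_rate_right x) (hq.rate_nonneg x) hK

end IsGlobalQFunction

end

/-! ### Feller's transition function as a kernel -/

section
theorem measurable_lintegral_kernel {α β γ : Type*} [MeasurableSpace α] [MeasurableSpace β]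
    [MeasurableSpace γ] (κ : Kernel α β) [IsSFiniteKernel κ]
    {g : γ → α} (hg : Measurable g) {f : γ → β → ℝ≥0∞} (hf : Measurable (Function.uncurry f)) :
    Measurable fun c => ∫⁻ b, f c b ∂κ (g c) :=
  Measurable.lintegral_kernel_prod_right' (κ := κ.comap g hg) hf

theorem measurableSet_mem_Ioo {γ : Type*} [MeasurableSpace γ] {f g h : γ → ℝ} (hf : Measurable f)
    (hg : Measurable g) (hh : Measurable h) : MeasurableSet {c | h c ∈ Ioo (f c) (g c)} :=
  (measurableSet_lt hf hh).inter (measurableSet_lt hh hg)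

/-- Both sides integrate over the triangle u < v < w < t, where Tonelli applies. -/
theorem lintegral_Ioo_Ioo_swap (u t : ℝ) {H : ℝ → ℝ → ℝ≥0∞}
    (hH : Measurable (Function.uncurry H)) :
    ∫⁻ v in Ioo u t, ∫⁻ w in Ioo v t, H v w = ∫⁻ w in Ioo u t, ∫⁻ v in Ioo u w, H v w := by
  simp_rw [← lintegral_indicator measurableSet_Ioo]
  have h1 : ∀ v, (Ioo u t).indicator (fun v => ∫⁻ w, (Ioo v t).indicator (H v) w) v =
      ∫⁻ w, {z : ℝ × ℝ | u < z.1 ∧ z.1 < z.2 ∧ z.2 < t}.indicator (Function.uncurry H) (v, w) := by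
    intro v
    by_cases hv : v ∈ Ioo u t
    · rw [indicator_of_mem hv]
      refine lintegral_congr fun w => ?_
      simp only [indicator, mem_Ioo, mem_ofPred_eq, Function.uncurry, hv.1, true_and]
    · rw [indicator_of_notMem hv, ← lintegral_zero (μ := (volume : Measure ℝ))]
      refine lintegral_congr fun w => (indicator_of_notMem ?_ _).symm
      rintro ⟨h1, h2, h3⟩
      exact hv ⟨h1, h2.trans h3⟩
  have h2 : ∀ w, (Ioo u t).indicator
      (fun w => ∫⁻ v, (Ioo u w).indicator (fun v => H v w) v) w =
      ∫⁻ v, {z : ℝ × ℝ | u < z.1 ∧ z.1 < z.2 ∧ z.2 < t}.indicator (Function.uncurry H) (v, w) := by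
    intro w
    by_cases hw : w ∈ Ioo u t
    · rw [indicator_of_mem hw]
      refine lintegral_congr fun v => ?_
      simp only [indicator, mem_Ioo, mem_ofPred_eq, Function.uncurry, hw.2, and_true]
    · rw [indicator_of_notMem hw, ← lintegral_zero (μ := (volume : Measure ℝ))]
      refine lintegral_congr fun v => (indicator_of_notMem ?_ _).symm
      rintro ⟨h1, h2, h3⟩
      exact hw ⟨h1.trans h2, h3⟩
  simp_rw [h1, h2]
  refine lintegral_lintegral_swap (Measurable.aemeasurable ?_)
  refine hH.indicator ?_
  exact (measurableSet_lt measurable_const measurable_fst).inter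
    ((measurableSet_lt measurable_fst measurable_snd).inter
      (measurableSet_lt measurable_snd measurable_const))

variable {X : Type*} [MeasurableSpace X] [StandardBorelSpace X] {q : X → ℝ → SignedMeasure X}

namespace IsGlobalQFunction

theorem measurable_survival_comp (hq : IsGlobalQFunction q) {γ : Type*} [MeasurableSpace γ]
    {x : γ → X} {u t : γ → ℝ} (hx : Measurable x) (hu : Measurable u) (ht : Measurable t) :
    Measurable fun c => survival q (x c) (u c) (t c) :=
  hq.measurable_survival.comp (hu.prodMk (hx.prodMk ht))

theorem measurable_ofReal_rate_comp (hq : IsGlobalQFunction q) {γ : Type*} [MeasurableSpace γ]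
    {x : γ → X} {t : γ → ℝ} (hx : Measurable x) (ht : Measurable t) :
    Measurable fun c => ENNReal.ofReal (rate q (x c) (t c)) :=
  (hq.measurable_rate.comp (hx.prodMk ht)).ennreal_ofReal

/-- The density on `]u,t[` of the first jump time of a process started at `x` at time `u`, without
the jump rate; the argument of the kernel is `(u,x,t)`. -/
def sojournKernel (_hq : IsGlobalQFunction q) : Kernel (ℝ × X × ℝ) ℝ :=
  (Kernel.const _ volume).withDensity
    fun a => (Ioo a.1 a.2.2).indicator fun w => survival q a.2.1 a.1 w

instance (hq : IsGlobalQFunction q) : IsSFiniteKernel hq.sojournKernel :=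
  Kernel.IsSFiniteKernel.withDensity _ fun a w => by
    by_cases h : w ∈ Ioo a.1 a.2.2 <;> simp [h, survival]

theorem lintegral_sojournKernel (hq : IsGlobalQFunction q) (u : ℝ) (x : X) (t : ℝ) {f : ℝ → ℝ≥0∞}
    (hf : Measurable f) :
    ∫⁻ w, f w ∂hq.sojournKernel (u, x, t) = ∫⁻ w in Ioo u t, survival q x u w * f w := by
  have hm : Measurable (Function.uncurry fun (a : ℝ × X × ℝ) =>
      (Ioo a.1 a.2.2).indicator fun w => survival q a.2.1 a.1 w) := by
    refine Measurable.indicator (f := fun z : (ℝ × X × ℝ) × ℝ => survival q z.1.2.1 z.1.1 z.2) ?_ ?_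
    · exact hq.measurable_survival_comp (by fun_prop) (by fun_prop) (by fun_prop)
    · exact measurableSet_mem_Ioo (by fun_prop) (by fun_prop) (by fun_prop)
  rw [sojournKernel, Kernel.lintegral_withDensity _ hm _ hf,
    Kernel.const_apply, ← lintegral_indicator measurableSet_Ioo]
  refine lintegral_congr fun w => ?_
  by_cases h : w ∈ Ioo u t <;> simp [h]

/-- The measures `P̄⁽ⁿ⁾(u,x;t,·)` as a kernel in `(u,x,t)`. -/
def iterKernel (hq : IsGlobalQFunction q) : ℕ → Kernel (ℝ × X × ℝ) X
  | 0 => (Kernel.deterministic (fun a => a.2.1) (by fun_prop)).withDensity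
      fun a _ => survival q a.2.1 a.1 a.2.2
  -- First jump time w, position y after it, n further jumps from (w, y) up to the same t. The jump
  -- rate enters as the mass of the jump kernel.
  | n + 1 => ((hq.sojournKernel ⊗ₖ hq.jumpKernel.comap
      (fun z : (ℝ × X × ℝ) × ℝ => (z.1.2.1, z.2)) (by fun_prop)) ⊗ₖ (iterKernel hq n).comap
      (fun z : (ℝ × X × ℝ) × ℝ × X => (z.2.1, z.2.2, z.1.2.2)) (by fun_prop)).snd

instance (hq : IsGlobalQFunction q) (n : ℕ) :
    IsSFiniteKernel (hq.iterKernel n) := by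
  induction n with
  | zero =>
    refine Kernel.IsSFiniteKernel.withDensity _ fun _ _ => ?_
    simp [survival]
  | succ n ih => rw [iterKernel]; infer_instance

theorem lintegral_iterKernel_zero (hq : IsGlobalQFunction q) (u : ℝ) (x : X) (t : ℝ)
    {f : X → ℝ≥0∞} (hf : Measurable f) :
    ∫⁻ z, f z ∂hq.iterKernel 0 (u, x, t) = survival q x u t * f x := by
  have hm : Measurable (Function.uncurry fun (a : ℝ × X × ℝ) (_ : X) =>
      survival q a.2.1 a.1 a.2.2) :=
    hq.measurable_survival_comp (by fun_prop) (by fun_prop) (by fun_prop)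
  rw [iterKernel, Kernel.lintegral_withDensity _ hm _ hf,
    Kernel.lintegral_deterministic' _ (by fun_prop)]

theorem lintegral_iterKernel_succ (hq : IsGlobalQFunction q) (n : ℕ) (u : ℝ) (x : X) (t : ℝ)
    {f : X → ℝ≥0∞} (hf : Measurable f) :
    ∫⁻ z, f z ∂hq.iterKernel (n + 1) (u, x, t) = ∫⁻ w in Ioo u t, survival q x u w *
      ∫⁻ y, ∫⁻ z, f z ∂hq.iterKernel n (w, y, t) ∂jumpMeasure q x w := by
  rw [iterKernel, Kernel.lintegral_snd _ _ hf,
    Kernel.lintegral_compProd _ _ _ (f := fun b => f b.2) (hf.comp measurable_snd)]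
  simp only [Kernel.comap_apply]
  have hm : Measurable fun b : ℝ × X => ∫⁻ z, f z ∂hq.iterKernel n (b.1, b.2, t) :=
    measurable_lintegral_kernel (hq.iterKernel n) (by fun_prop) (hf.comp measurable_snd)
  rw [Kernel.lintegral_compProd _ _ _ hm]
  simp only [Kernel.comap_apply]
  rw [hq.lintegral_sojournKernel]
  · rfl
  · exact measurable_lintegral_kernel hq.jumpKernel (g := fun w => (x, w)) (by fun_prop) hm

/-- Through this identification the recursively defined set functions become measures in B, jointly
measurable in (u, x, t). -/
theorem iterKernel_apply (hq : IsGlobalQFunction q) (n : ℕ) (u : ℝ) (x : X) (t : ℝ) {B : Set X}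
    (hB : MeasurableSet B) : hq.iterKernel n (u, x, t) B = PbarN q n u x t B := by
  induction n generalizing u x with
  | zero =>
    rw [← lintegral_indicator_one hB,
      hq.lintegral_iterKernel_zero _ _ _ (measurable_one.indicator hB), mul_comm]
    rfl
  | succ n ih =>
    rw [← lintegral_indicator_one hB,
      hq.lintegral_iterKernel_succ _ _ _ _ (measurable_one.indicator hB)]
    simp only [lintegral_indicator_one hB, ih, PbarN]
    refine lintegral_congr fun w => (lintegral_const_mul _ ?_).symm
    simp_rw [← ih]
    exact (hq.iterKernel n).measurable_coe hB |>.comp (by fun_prop)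

/-- The sum is the probability of fewer than N jumps. After the first jump the induction hypothesis
bounds the rest by 1, and survival plus the first-jump density has total 1. -/
theorem sum_iterKernel_univ_le_one (hq : IsGlobalQFunction q) (N : ℕ) {u : ℝ} (x : X) {t : ℝ}
    (hut : u ≤ t) : ∑ n ∈ Finset.range N, hq.iterKernel n (u, x, t) univ ≤ 1 := by
  induction N generalizing u x with
  | zero => simp
  | succ N ih =>
    rw [Finset.sum_range_succ', add_comm]
    calc _ = survival q x u t + ∫⁻ w in Ioo u t, survival q x u w *
          ∫⁻ y, ∑ n ∈ Finset.range N, hq.iterKernel n (w, y, t) univ ∂jumpMeasure q x w := by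
          have hm : ∀ n, Measurable fun b : ℝ × X => hq.iterKernel n (b.1, b.2, t) univ :=
            fun n => ((hq.iterKernel n).measurable_coe .univ).comp (by fun_prop)
          have h0 := hq.lintegral_iterKernel_zero u x t measurable_one
          have h1 := fun n => hq.lintegral_iterKernel_succ n u x t measurable_one
          simp only [Pi.one_apply, lintegral_one, mul_one] at h0 h1
          simp only [h0, h1]
          rw [← lintegral_finsetSum]
          · congr 1
            refine lintegral_congr fun w => ?_
            rw [lintegral_finsetSum, Finset.mul_sum]
            exact fun n _ => (hm n).comp measurable_prodMk_left
          · exact fun n _ => (hq.measurable_survival_comp measurable_const measurable_const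
              measurable_id).mul (measurable_lintegral_kernel hq.jumpKernel
                (g := fun w => (x, w)) (by fun_prop) (hm n))
      _ ≤ survival q x u t + ∫⁻ w in Ioo u t, ENNReal.ofReal (rate q x w) * survival q x u w := by
          gcongr _ + ?_
          refine setLIntegral_mono_ae' measurableSet_Ioo (.of_forall fun w hw => ?_)
          rw [mul_comm, ← hq.jumpMeasure_univ]
          gcongr
          calc _ ≤ ∫⁻ _, 1 ∂jumpMeasure q x w := lintegral_mono fun y => ih y hw.2.le
            _ = _ := lintegral_one
      _ = 1 := hq.survival_add_lintegral_left x hut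

/-- Feller's transition function as a kernel in `(u,x,t)`. -/
def fellerKernel (hq : IsGlobalQFunction q) : Kernel (ℝ × X × ℝ) X :=
  Kernel.sum hq.iterKernel

theorem fellerKernel_apply (hq : IsGlobalQFunction q) (u : ℝ) (x : X) (t : ℝ) {B : Set X}
    (hB : MeasurableSet B) : hq.fellerKernel (u, x, t) B = Pbar q u x t B := by
  rw [fellerKernel, Kernel.sum_apply' _ _ hB]
  exact tsum_congr fun n => hq.iterKernel_apply n u x t hB

theorem fellerKernel_univ_le_one (hq : IsGlobalQFunction q) {u : ℝ} (x : X) {t : ℝ}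
    (hut : u ≤ t) : hq.fellerKernel (u, x, t) univ ≤ 1 := by
  rw [fellerKernel, Kernel.sum_apply' _ _ .univ]
  exact ENNReal.tsum_le_of_sum_range_le fun N => hq.sum_iterKernel_univ_le_one N x hut

/-- The law of the post-jump positions at each time `w`, when the pre-jump positions have law
`κ w`. -/
def fluxKernel (hq : IsGlobalQFunction q) (κ : Kernel ℝ X) :
    Kernel ℝ X :=
  (κ ⊗ₖ hq.jumpKernel.comap Prod.swap measurable_swap).snd

instance (hq : IsGlobalQFunction q) (κ : Kernel ℝ X) :
    IsSFiniteKernel (hq.fluxKernel κ) := by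
  rw [fluxKernel]; infer_instance

theorem lintegral_fluxKernel (hq : IsGlobalQFunction q) (κ : Kernel ℝ X)
    [IsSFiniteKernel κ] (w : ℝ) {f : X → ℝ≥0∞} (hf : Measurable f) :
    ∫⁻ z, f z ∂hq.fluxKernel κ w = ∫⁻ y, ∫⁻ z, f z ∂jumpMeasure q y w ∂κ w := by
  rw [fluxKernel, Kernel.lintegral_snd _ _ hf,
    Kernel.lintegral_compProd _ _ _ (f := fun b => f b.2) (hf.comp measurable_snd)]
  rfl

theorem fluxKernel_apply (hq : IsGlobalQFunction q) (κ : Kernel ℝ X)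
    [IsSFiniteKernel κ] (w : ℝ) {B : Set X} (hB : MeasurableSet B) :
    hq.fluxKernel κ w B = ∫⁻ y, ENNReal.ofReal (q y w (B \ {y})) ∂κ w := by
  rw [← lintegral_indicator_one hB, hq.lintegral_fluxKernel κ w (measurable_one.indicator hB)]
  refine lintegral_congr fun y => ?_
  rw [lintegral_indicator_one hB, hq.jumpMeasure_apply y w hB]

/-- The forward form of the recursion that defines `P̄⁽ⁿ⁾`. -/
theorem lintegral_iterKernel_succ_forward (hq : IsGlobalQFunction q) (n : ℕ) (u : ℝ) (x : X)
    (t : ℝ) {f : X → ℝ≥0∞} (hf : Measurable f) :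
    ∫⁻ z, f z ∂hq.iterKernel (n + 1) (u, x, t) =
      ∫⁻ w in Ioo u t, ∫⁻ y, ∫⁻ z, f z * survival q z w t ∂jumpMeasure q y w
        ∂hq.iterKernel n (u, x, w) := by
  have hG : Measurable fun b : ℝ × X =>
      ∫⁻ z, f z * survival q z b.1 t ∂jumpMeasure q b.2 b.1 :=
    measurable_lintegral_kernel hq.jumpKernel (g := fun b : ℝ × X => (b.2, b.1)) (by fun_prop)
      (f := fun b z => f z * survival q z b.1 t)
      ((hf.comp measurable_snd).mul
        (hq.measurable_survival_comp (by fun_prop) (by fun_prop) (by fun_prop)))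
  induction n generalizing u x with
  | zero =>
    rw [hq.lintegral_iterKernel_succ _ _ _ _ hf]
    refine lintegral_congr fun w => ?_
    rw [hq.lintegral_iterKernel_zero _ _ _
      (f := fun y => ∫⁻ z, f z * survival q z w t ∂jumpMeasure q y w)
      (hG.comp measurable_prodMk_left)]
    simp only [hq.lintegral_iterKernel_zero _ _ _ hf, mul_comm]
  | succ n ih =>
    rw [hq.lintegral_iterKernel_succ _ _ _ _ hf]
    -- The first jump, at v, comes from the definition and the last, at w, from the induction
    -- hypothesis; the two sides differ in the order of integration over u < v < w < t.
    simp_rw [ih, fun w => hq.lintegral_iterKernel_succ n u x w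
      (f := fun y => ∫⁻ z, f z * survival q z w t ∂jumpMeasure q y w)
      (hG.comp measurable_prodMk_left)]
    have hh : Measurable fun b : ℝ × X × ℝ => ∫⁻ y, ∫⁻ z, f z * survival q z b.2.2 t
        ∂jumpMeasure q y b.2.2 ∂hq.iterKernel n b :=
      measurable_lintegral_kernel (hq.iterKernel n) measurable_id
        (f := fun b y => ∫⁻ z, f z * survival q z b.2.2 t ∂jumpMeasure q y b.2.2)
        (hG.comp (by fun_prop : Measurable fun z : (ℝ × X × ℝ) × X => (z.1.2.2, z.2)))
    rw [← lintegral_Ioo_Ioo_swap u t (H := fun v w => survival q x u v * ∫⁻ y, ∫⁻ y', ∫⁻ z,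
      f z * survival q z w t ∂jumpMeasure q y' w ∂hq.iterKernel n (v, y, w) ∂jumpMeasure q x v)]
    · refine lintegral_congr fun v => ?_
      have : SFinite (jumpMeasure q x v) :=
        inferInstanceAs (SFinite (hq.jumpKernel (x, v)))
      rw [lintegral_const_mul, lintegral_lintegral_swap]
      · exact (hh.comp (by fun_prop : Measurable fun z : X × ℝ => (v, z.1, z.2))).aemeasurable
      · exact measurable_lintegral_kernel hq.jumpKernel (g := fun _ : ℝ => (x, v)) (by fun_prop)
          (hh.comp (by fun_prop : Measurable fun z : ℝ × X => (v, z.2, z.1)))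
    · refine (hq.measurable_survival_comp measurable_const measurable_const measurable_fst).mul ?_
      exact measurable_lintegral_kernel hq.jumpKernel (g := fun z : ℝ × ℝ => (x, z.1))
        (by fun_prop)
        (hh.comp (by fun_prop : Measurable fun z : (ℝ × ℝ) × X => (z.1.1, z.2, z.1.2)))

end IsGlobalQFunction

end

/-! ### Evolution equations and variation of constants -/

section
variable {X : Type*} [MeasurableSpace X] [StandardBorelSpace X] {q : X → ℝ → SignedMeasure X}

namespace IsGlobalQFunction

/-- Mass balance for particles that are born according to `φ` and killed at rate `q`: those alive at
time `t` and those killed before `t` make up those born before `t`. -/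
theorem lintegral_survival_add_lintegral_killed (hq : IsGlobalQFunction q) (φ : Kernel ℝ X)
    [IsSFiniteKernel φ] (u t : ℝ) {f : X → ℝ≥0∞} (hf : Measurable f) :
    (∫⁻ v in Ioo u t, ∫⁻ z, f z * survival q z v t ∂φ v) +
      ∫⁻ w in Ioo u t, ∫⁻ v in Ioo u w,
        ∫⁻ z, f z * ENNReal.ofReal (rate q z w) * survival q z v w ∂φ v =
      ∫⁻ v in Ioo u t, ∫⁻ z, f z ∂φ v := by
  have hm : Measurable fun p : ℝ × ℝ × X =>
      f p.2.2 * ENNReal.ofReal (rate q p.2.2 p.2.1) * survival q p.2.2 p.1 p.2.1 :=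
    ((hf.comp (by fun_prop)).mul (hq.measurable_ofReal_rate_comp (by fun_prop) (by fun_prop))).mul
      (hq.measurable_survival_comp (by fun_prop) (by fun_prop) (by fun_prop))
  have hs : Measurable (Function.uncurry fun v z => f z * survival q z v t) :=
    (hf.comp measurable_snd).mul
      (hq.measurable_survival_comp (by fun_prop) (by fun_prop) (by fun_prop))
  rw [← lintegral_Ioo_Ioo_swap u t (H := fun v w =>
    ∫⁻ z, f z * ENNReal.ofReal (rate q z w) * survival q z v w ∂φ v)
    (measurable_lintegral_kernel φ (g := fun p : ℝ × ℝ => p.1) (by fun_prop)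
      (f := fun p z => f z * ENNReal.ofReal (rate q z p.2) * survival q z p.1 p.2)
      (hm.comp (by fun_prop : Measurable fun p : (ℝ × ℝ) × X => (p.1.1, p.1.2, p.2)))),
    ← lintegral_add_left (measurable_lintegral_kernel φ (g := fun v => v) (by fun_prop)
      (f := fun v z => f z * survival q z v t) hs)]
  -- For each birth time v and position z, survival to t and killing before t have total weight 1.
  refine setLIntegral_congr_fun measurableSet_Ioo fun v hv => ?_
  rw [lintegral_lintegral_swap (f := fun w z => f z * ENNReal.ofReal (rate q z w) *
    survival q z v w) (hm.comp measurable_prodMk_left).aemeasurable,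
    ← lintegral_add_left (f := fun z => f z * survival q z v t) (hs.comp measurable_prodMk_left)]
  refine lintegral_congr fun z => ?_
  simp only [mul_assoc]
  rw [lintegral_const_mul, ← mul_add, hq.survival_add_lintegral_left z hv.2.le, mul_one]
  exact (hq.measurable_ofReal_rate_comp (by fun_prop) (by fun_prop)).mul
    (hq.measurable_survival_comp (by fun_prop) (by fun_prop) (by fun_prop))

/-- The integrated evolution equation of the measures `κ w`, with source `φ` and killing rate `q`,
tested against functions instead of sets. -/
theorem lintegral_evolution (hq : IsGlobalQFunction q) (κ φ : Kernel ℝ X) [IsSFiniteKernel κ]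
    [IsSFiniteKernel φ] (u : ℝ) (x : X) (w : ℝ) (c : ℝ≥0∞)
    (h : ∀ C, MeasurableSet C →
      κ w C + ∫⁻ v in Ioo u w, ∫⁻ y in C, ENNReal.ofReal (rate q y v) ∂κ v =
        c * C.indicator 1 x + ∫⁻ v in Ioo u w, φ v C) {f : X → ℝ≥0∞} (hf : Measurable f) :
    (∫⁻ y, f y ∂κ w) + ∫⁻ v in Ioo u w, ∫⁻ y, f y * ENNReal.ofReal (rate q y v) ∂κ v =
      c * f x + ∫⁻ v in Ioo u w, ∫⁻ y, f y ∂φ v := by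
  have hr : Measurable fun p : ℝ × X => ENNReal.ofReal (rate q p.2 p.1) :=
    hq.measurable_ofReal_rate_comp (by fun_prop) (by fun_prop)
  have hκ : ∀ {g : X → ℝ≥0∞}, Measurable g →
      Measurable fun v => ∫⁻ y, g y * ENNReal.ofReal (rate q y v) ∂κ v := fun hg =>
    measurable_lintegral_kernel κ measurable_id
      (f := fun v y => _ * ENNReal.ofReal (rate q y v)) ((hg.comp measurable_snd).mul hr)
  have hφ : ∀ {g : X → ℝ≥0∞}, Measurable g → Measurable fun v => ∫⁻ y, g y ∂φ v := fun hg =>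
    hg.lintegral_kernel
  have hr' : ∀ v, Measurable fun y => ENNReal.ofReal (rate q y v) := fun v =>
    hr.comp measurable_prodMk_left
  -- With no subtraction in the equation, every term is additive in f and continuous along
  -- increasing sequences; indicators are covered by `h`.
  refine Measurable.ennreal_induction ?_ ?_ ?_ hf
  · intro a C hC
    have e1 : ∀ v, ∫⁻ y, C.indicator (fun _ => a) y * ENNReal.ofReal (rate q y v) ∂κ v =
        a * ∫⁻ y in C, ENNReal.ofReal (rate q y v) ∂κ v := fun v => by
      rw [← lintegral_const_mul _ (hr' v), ← lintegral_indicator hC]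
      refine lintegral_congr fun y => ?_
      by_cases hy : y ∈ C <;> simp [hy]
    have hm1 : Measurable fun v => ∫⁻ y in C, ENNReal.ofReal (rate q y v) ∂κ v := by
      simpa [indicator, ← lintegral_indicator hC] using
        hκ (g := C.indicator 1) (measurable_one.indicator hC)
    simp_rw [e1, lintegral_indicator_const hC]
    rw [lintegral_const_mul _ hm1, lintegral_const_mul _ (φ.measurable_coe hC), ← mul_add, h C hC,
      mul_add]
    by_cases hx : x ∈ C <;> simp [hx, mul_comm]
  · intro f g _ hf hg ihf ihg
    have h1 : ∀ v, ∫⁻ y, (f + g) y * ENNReal.ofReal (rate q y v) ∂κ v =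
        (∫⁻ y, f y * ENNReal.ofReal (rate q y v) ∂κ v) +
          ∫⁻ y, g y * ENNReal.ofReal (rate q y v) ∂κ v := fun v => by
      rw [← lintegral_add_left (f := fun y => f y * ENNReal.ofReal (rate q y v)) (hf.mul (hr' v))]
      exact lintegral_congr fun y => add_mul _ _ _
    have h2 : ∀ μ : Measure X, ∫⁻ y, (f + g) y ∂μ = (∫⁻ y, f y ∂μ) + ∫⁻ y, g y ∂μ := fun μ =>
      lintegral_add_left hf g
    simp_rw [h1, h2, Pi.add_apply]
    rw [lintegral_add_left (hκ hf), lintegral_add_left (hφ hf), mul_add, add_add_add_comm, ihf, ihg,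
      add_add_add_comm]
  · intro f hf hmono ih
    have hr0 : ∀ v, ∀ n, Measurable fun y => f n y * ENNReal.ofReal (rate q y v) :=
      fun v n => (hf n).mul (hr' v)
    have hmr : ∀ v, Monotone fun n y => f n y * ENNReal.ofReal (rate q y v) :=
      fun v m n hmn y => by have := hmono hmn y; dsimp only; gcongr
    simp_rw [ENNReal.iSup_mul, lintegral_iSup hf hmono, fun v => lintegral_iSup (hr0 v) (hmr v)]
    rw [lintegral_iSup (fun n => hκ (hf n)) fun m n hmn v => lintegral_mono (hmr v hmn),
      lintegral_iSup (fun n => hφ (hf n)) fun m n hmn v => lintegral_mono (hmono hmn),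
      ENNReal.mul_iSup, ENNReal.iSup_add_iSup_of_monotone, ENNReal.iSup_add_iSup_of_monotone]
    · exact iSup_congr ih
    · exact fun m n hmn => by have := hmono hmn x; gcongr
    · exact fun m n hmn => lintegral_mono fun v => lintegral_mono (hmono hmn)
    · exact fun m n hmn => lintegral_mono (hmono hmn)
    · exact fun m n hmn => lintegral_mono fun v => lintegral_mono (hmr v hmn)

/-- Variation of constants: the integrated evolution equation determines `κ t`. -/
theorem evolution_apply_univ (hq : IsGlobalQFunction q) (κ φ : Kernel ℝ X) [IsSFiniteKernel κ]
    [IsSFiniteKernel φ] {u t : ℝ} (hut : u < t) (x : X) (c : ℝ≥0∞)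
    (h : ∀ w ∈ Ioc u t, ∀ C, MeasurableSet C →
      κ w C + ∫⁻ v in Ioo u w, ∫⁻ y in C, ENNReal.ofReal (rate q y v) ∂κ v =
        c * C.indicator 1 x + ∫⁻ v in Ioo u w, φ v C)
    (hfin : ∫⁻ v in Ioo u t, ∫⁻ y, ENNReal.ofReal (rate q y v) ∂κ v ≠ ∞) :
    κ t univ = c * survival q x u t + ∫⁻ v in Ioo u t, ∫⁻ z, survival q z v t ∂φ v := by
  -- `a w y` is almost everywhere the derivative in w of `survival q y w t`. Testing the equation at
  -- time w with `a w` and integrating over w thus replaces integration by parts.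
  set a : ℝ → X → ℝ≥0∞ := fun w y => ENNReal.ofReal (rate q y w) * survival q y w t with ha
  have hr : Measurable fun p : ℝ × X => ENNReal.ofReal (rate q p.2 p.1) :=
    hq.measurable_ofReal_rate_comp (by fun_prop) (by fun_prop)
  have hS : Measurable fun p : ℝ × X => survival q p.2 p.1 t :=
    hq.measurable_survival_comp (by fun_prop) (by fun_prop) (by fun_prop)
  have ham : Measurable fun p : ℝ × X => a p.1 p.2 := hr.mul hS
  have haI : ∀ v < t, ∀ y, survival q y v t + ∫⁻ w in Ioo v t, a w y = 1 := fun v hv y =>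
    hq.survival_add_lintegral_right y hv.le
  have hφI : ∀ (ψ : Kernel ℝ X) [IsSFiniteKernel ψ] (b : ℝ → X → ℝ≥0∞)
      (_ : Measurable fun p : ℝ × X => b p.1 p.2),
      (∫⁻ v in Ioo u t, ∫⁻ y, b v y * survival q y v t ∂ψ v) +
        ∫⁻ w in Ioo u t, ∫⁻ v in Ioo u w, ∫⁻ y, a w y * b v y ∂ψ v =
        ∫⁻ v in Ioo u t, ∫⁻ y, b v y ∂ψ v := by
    intro ψ _ b hb
    have hm : Measurable fun p : (ℝ × ℝ) × X => a p.1.2 p.2 * b p.1.1 p.2 :=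
      (ham.comp (by fun_prop : Measurable fun p : (ℝ × ℝ) × X => (p.1.2, p.2))).mul
        (hb.comp (by fun_prop : Measurable fun p : (ℝ × ℝ) × X => (p.1.1, p.2)))
    have hm' : Measurable fun p : ℝ × X => b p.1 p.2 * survival q p.2 p.1 t := hb.mul hS
    rw [← lintegral_Ioo_Ioo_swap u t (H := fun v w => ∫⁻ y, a w y * b v y ∂ψ v)
      (measurable_lintegral_kernel ψ measurable_fst
        (f := fun (p : ℝ × ℝ) y => a p.2 y * b p.1 y) hm),
      ← lintegral_add_left (measurable_lintegral_kernel ψ (g := fun v => v) measurable_id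
        (f := fun v y => b v y * survival q y v t) hm')]
    refine setLIntegral_congr_fun measurableSet_Ioo fun v hv => ?_
    rw [lintegral_lintegral_swap (f := fun w y => a w y * b v y) (hm.comp
      (by fun_prop : Measurable fun p : ℝ × X => ((v, p.1), p.2))).aemeasurable,
      ← lintegral_add_left (f := fun y => b v y * survival q y v t)
        (hm'.comp measurable_prodMk_left)]
    refine lintegral_congr fun y => ?_
    rw [lintegral_mul_const (f := fun w => a w y) _
      (ham.comp (by fun_prop : Measurable fun w : ℝ => (w, y)))]
    rw [mul_comm, ← add_mul, haI v hv.2 y, one_mul]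
  have hE : (∫⁻ w in Ioo u t, ∫⁻ y, a w y ∂κ w) + (∫⁻ w in Ioo u t, ∫⁻ v in Ioo u w,
      ∫⁻ y, a w y * ENNReal.ofReal (rate q y v) ∂κ v) =
      c * (∫⁻ w in Ioo u t, a w x) + ∫⁻ w in Ioo u t, ∫⁻ v in Ioo u w, ∫⁻ y, a w y ∂φ v := by
    have hax : Measurable fun w => a w x :=
      ham.comp (by fun_prop : Measurable fun w : ℝ => (w, x))
    rw [← lintegral_add_left (measurable_lintegral_kernel κ (g := fun v => v) measurable_id
        (f := a) ham),
      ← lintegral_const_mul _ hax, ← lintegral_add_left (hax.const_mul c)]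
    exact setLIntegral_congr_fun measurableSet_Ioo fun w hw =>
      hq.lintegral_evolution κ φ u x w c (h w ⟨hw.1, hw.2.le⟩) (ham.comp measurable_prodMk_left)
  have h1 := hφI κ (fun v y => ENNReal.ofReal (rate q y v)) hr
  have h2 := hφI φ (fun _ _ => 1) measurable_const
  simp only [one_mul, mul_one, lintegral_one] at h2
  have h3 := h t ⟨hut, le_rfl⟩ univ .univ
  simp only [Measure.restrict_univ, indicator_univ, Pi.one_apply, mul_one] at h3
  have h4 := haI u hut x
  change (∫⁻ v in Ioo u t, ∫⁻ y, a v y ∂κ v) + _ = _ at h1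
  rw [h1] at hE
  rw [← h2] at h3
  -- The total killed mass occurs on both sides; `hfin` permits its cancellation.
  refine (ENNReal.add_left_inj hfin).1 (h3.trans ?_)
  rw [hE]
  nth_rw 1 [← mul_one c, ← h4]
  rw [mul_add]
  abel

end IsGlobalQFunction

end

/-! ### Forward equation and minimality over all real times -/

section
-- Comparisons are available only inside q-bounded sets; continuity from below removes the
-- restriction.
theorem measure_le_of_forall_subset {α : Type*} [MeasurableSpace α] {μ ν : Measure α}
    {D : ℕ → Set α} (hD : Monotone D) (hDm : ∀ k, MeasurableSet (D k)) (hDu : ⋃ k, D k = univ)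
    (h : ∀ k, ∀ C ⊆ D k, MeasurableSet C → μ C ≤ ν C) : μ ≤ ν := by
  refine Measure.le_iff.2 fun B hB => ?_
  have hmono : Monotone fun k => B ∩ D k := fun i j hij => inter_subset_inter_right _ (hD hij)
  have hBu : B = ⋃ k, B ∩ D k := by rw [← inter_iUnion, hDu, inter_univ]
  rw [hBu, hmono.measure_iUnion]
  exact iSup_le fun k => (h k _ inter_subset_right (hB.inter (hDm k))).trans
    (measure_mono (subset_iUnion (fun k => B ∩ D k) k))

variable {X : Type*} [MeasurableSpace X] [StandardBorelSpace X] {q : X → ℝ → SignedMeasure X}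

namespace IsGlobalQFunction

/-- The measures `P̄⁽ⁿ⁾(u,x;w,·)` as a kernel in `w`. -/
def pathKernel (hq : IsGlobalQFunction q) (n : ℕ) (u : ℝ) (x : X) : Kernel ℝ X :=
  (hq.iterKernel n).comap (fun w => (u, x, w)) (by fun_prop)

@[simp]
theorem pathKernel_apply (hq : IsGlobalQFunction q) (n : ℕ) (u : ℝ) (x : X) (w : ℝ) :
    hq.pathKernel n u x w = hq.iterKernel n (u, x, w) := rfl

instance (hq : IsGlobalQFunction q) (n : ℕ) (u : ℝ) (x : X) :
    IsSFiniteKernel (hq.pathKernel n u x) := by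
  rw [pathKernel]; infer_instance

theorem lintegral_pathKernel_succ (hq : IsGlobalQFunction q) (n : ℕ) (u : ℝ) (x : X) (t : ℝ)
    {f : X → ℝ≥0∞} (hf : Measurable f) :
    ∫⁻ z, f z ∂hq.pathKernel (n + 1) u x t =
      ∫⁻ w in Ioo u t, ∫⁻ z, f z * survival q z w t ∂hq.fluxKernel (hq.pathKernel n u x) w := by
  rw [pathKernel_apply, hq.lintegral_iterKernel_succ_forward n u x t hf]
  refine lintegral_congr fun w => ?_
  rw [hq.lintegral_fluxKernel]
  · rfl
  · exact hf.mul (hq.measurable_survival_comp (by fun_prop) (by fun_prop) (by fun_prop))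

theorem lintegral_pathKernel_zero_add (hq : IsGlobalQFunction q) {u : ℝ} (x : X) {t : ℝ}
    (hut : u ≤ t) {f : X → ℝ≥0∞} (hf : Measurable f) :
    (∫⁻ z, f z ∂hq.pathKernel 0 u x t) +
      ∫⁻ w in Ioo u t, ∫⁻ z, f z * ENNReal.ofReal (rate q z w) ∂hq.pathKernel 0 u x w = f x := by
  simp only [pathKernel_apply]
  rw [hq.lintegral_iterKernel_zero _ _ _ hf]
  have h : ∀ w, ∫⁻ z, f z * ENNReal.ofReal (rate q z w) ∂hq.iterKernel 0 (u, x, w) =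
      f x * (ENNReal.ofReal (rate q x w) * survival q x u w) := fun w => by
    rw [hq.lintegral_iterKernel_zero (f := fun z => f z * ENNReal.ofReal (rate q z w)) _ _ _
      (hf.mul (hq.measurable_ofReal_rate_comp (by fun_prop) (by fun_prop)))]
    ring
  simp_rw [h]
  rw [lintegral_const_mul, mul_comm, ← mul_add, hq.survival_add_lintegral_left x hut, mul_one]
  exact (hq.measurable_ofReal_rate_comp (by fun_prop) (by fun_prop)).mul
    (hq.measurable_survival_comp (by fun_prop) (by fun_prop) (by fun_prop))

/-- Generation n + 1 is born from the flux of generation n and killed at rate q, so the general mass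
balance applies. -/
theorem lintegral_pathKernel_succ_add (hq : IsGlobalQFunction q) (n : ℕ) (u : ℝ) (x : X) (t : ℝ)
    {f : X → ℝ≥0∞} (hf : Measurable f) :
    (∫⁻ z, f z ∂hq.pathKernel (n + 1) u x t) + ∫⁻ w in Ioo u t,
        ∫⁻ z, f z * ENNReal.ofReal (rate q z w) ∂hq.pathKernel (n + 1) u x w =
      ∫⁻ w in Ioo u t, ∫⁻ z, f z ∂hq.fluxKernel (hq.pathKernel n u x) w := by
  rw [← hq.lintegral_survival_add_lintegral_killed _ u t hf, hq.lintegral_pathKernel_succ n u x t hf]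
  congr 1
  exact lintegral_congr fun w => hq.lintegral_pathKernel_succ n u x w
    (hf.mul (hq.measurable_ofReal_rate_comp (by fun_prop) (by fun_prop)))

theorem lintegral_fellerKernel (hq : IsGlobalQFunction q) (a : ℝ × X × ℝ) (f : X → ℝ≥0∞) :
    ∫⁻ z, f z ∂hq.fellerKernel a = ∑' n, ∫⁻ z, f z ∂hq.iterKernel n a := by
  rw [fellerKernel, Kernel.sum_apply, lintegral_sum_measure]

/-- The integrated forward equation for Feller's transition function, tested against functions. -/
theorem fellerKernel_forward (hq : IsGlobalQFunction q) {u : ℝ} (x : X) {t : ℝ}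
    (hut : u ≤ t) {f : X → ℝ≥0∞} (hf : Measurable f) :
    (∫⁻ z, f z ∂hq.fellerKernel (u, x, t)) +
      ∫⁻ w in Ioo u t, ∫⁻ z, f z * ENNReal.ofReal (rate q z w) ∂hq.fellerKernel (u, x, w) =
    f x + ∫⁻ w in Ioo u t, ∫⁻ y, ∫⁻ z, f z ∂jumpMeasure q y w ∂hq.fellerKernel (u, x, w) := by
  simp_rw [hq.lintegral_fellerKernel]
  -- Births of generation n + 1 are jumps of generation n: once the term n = 0 is split off on the
  -- left, the sums match.
  rw [lintegral_tsum, lintegral_tsum, ← ENNReal.tsum_add, tsum_eq_zero_add' ENNReal.summable]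
  · congr 1
    · exact hq.lintegral_pathKernel_zero_add x hut hf
    · refine tsum_congr fun n => (hq.lintegral_pathKernel_succ_add n u x t hf).trans ?_
      exact lintegral_congr fun w => hq.lintegral_fluxKernel _ w hf
  · intro n
    refine (measurable_lintegral_kernel (hq.pathKernel n u x) (g := fun w => w) measurable_id
      (f := fun w y => ∫⁻ z, f z ∂jumpMeasure q y w) ?_).aemeasurable
    exact measurable_lintegral_kernel hq.jumpKernel (g := fun p : ℝ × X => (p.2, p.1))
      (by fun_prop) (hf.comp measurable_snd)
  · intro n
    exact (measurable_lintegral_kernel (hq.pathKernel n u x) (g := fun w => w) measurable_id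
      (f := fun w y => f y * ENNReal.ofReal (rate q y w)) ((hf.comp measurable_snd).mul
        (hq.measurable_ofReal_rate_comp (by fun_prop) (by fun_prop)))).aemeasurable

/-- Variation of constants on a set `B` on which the forward equation holds. -/
theorem evolution_apply (hq : IsGlobalQFunction q) (κ φ : Kernel ℝ X) [IsSFiniteKernel κ]
    [IsSFiniteKernel φ] {u t : ℝ} (hut : u < t) (x : X) {B : Set X} (hB : MeasurableSet B)
    (h : ∀ w ∈ Ioc u t, ∀ C ⊆ B, MeasurableSet C →
      κ w C + ∫⁻ v in Ioo u w, ∫⁻ y in C, ENNReal.ofReal (rate q y v) ∂κ v =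
        C.indicator 1 x + ∫⁻ v in Ioo u w, φ v C)
    (hfin : ∫⁻ v in Ioo u t, ∫⁻ y in B, ENNReal.ofReal (rate q y v) ∂κ v ≠ ∞) :
    κ t B = B.indicator 1 x * survival q x u t +
      ∫⁻ v in Ioo u t, ∫⁻ z in B, survival q z v t ∂φ v := by
  -- Restriction to B turns an equation for subsets of B into one for all sets, with initial mass
  -- `B.indicator 1 x`.
  have := hq.evolution_apply_univ (κ.restrict hB) (φ.restrict hB) hut x (B.indicator 1 x)
    (fun w hw C hC => ?_) (by simpa only [Kernel.restrict_apply] using hfin)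
  · simpa only [Kernel.restrict_apply, Measure.restrict_apply_univ] using this
  · simp only [Kernel.restrict_apply, Measure.restrict_restrict hC, Measure.restrict_apply hC]
    rw [h w hw _ inter_subset_right (hC.inter hB), inter_comm, inter_indicator_one]
    rfl

/-- Minimality of Feller's transition function among the solutions `κ` of the forward equation. -/
theorem fellerKernel_le (hq : IsGlobalQFunction q) (κ : Kernel ℝ X) [IsSFiniteKernel κ] {u t : ℝ}
    (x : X) {D : ℕ → Set X} (hD : Monotone D) (hDm : ∀ k, MeasurableSet (D k))
    (hDu : ⋃ k, D k = univ)
    (h : ∀ k, ∀ w ∈ Ioc u t, ∀ C ⊆ D k, MeasurableSet C →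
      κ w C + ∫⁻ v in Ioo u w, ∫⁻ y in C, ENNReal.ofReal (rate q y v) ∂κ v =
        C.indicator 1 x + ∫⁻ v in Ioo u w, hq.fluxKernel κ v C)
    (hfin : ∀ k, ∫⁻ v in Ioo u t, ∫⁻ y in D k, ENNReal.ofReal (rate q y v) ∂κ v ≠ ∞)
    (hut : u < t) : hq.fellerKernel (u, x, t) ≤ κ t := by
  -- The bound must hold at all times up to t, since the induction step uses the flux at earlier
  -- times.
  have key : ∀ N, ∀ w ∈ Ioc u t,
      ∑ n ∈ Finset.range N, hq.pathKernel n u x w ≤ κ w := by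
    intro N
    induction N with
    | zero => intro w _; simpa using Measure.zero_le _
    | succ N ih =>
      intro w hw
      refine measure_le_of_forall_subset hD hDm hDu fun k C hCk hC => ?_
      have hsub : Ioo u w ⊆ Ioo u t := Ioo_subset_Ioo_right hw.2
      have hfinC : ∫⁻ v in Ioo u w, ∫⁻ y in C, ENNReal.ofReal (rate q y v) ∂κ v ≠ ∞ :=
        ((lintegral_mono_set hsub).trans (lintegral_mono fun v =>
          lintegral_mono_set hCk)).trans_lt (hfin k).lt_top |>.ne
      have hκ := hq.evolution_apply κ (hq.fluxKernel κ) hw.1 x hC (fun v hv C' hC' hm =>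
        h k v ⟨hv.1, hv.2.trans hw.2⟩ C' (hC'.trans hCk) hm) hfinC
      have hCi : Measurable (C.indicator (1 : X → ℝ≥0∞)) := measurable_one.indicator hC
      have hG : Measurable fun p : ℝ × X =>
          ∫⁻ z, C.indicator 1 z * survival q z p.1 w ∂jumpMeasure q p.2 p.1 :=
        measurable_lintegral_kernel hq.jumpKernel (g := fun p : ℝ × X => (p.2, p.1)) (by fun_prop)
          (f := fun p z => C.indicator 1 z * survival q z p.1 w)
          ((hCi.comp measurable_snd).mul
            (hq.measurable_survival_comp (by fun_prop) (by fun_prop) (by fun_prop)))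
      have hS : ∀ v, Measurable fun z => C.indicator 1 z * survival q z v w := fun v =>
        hCi.mul (hq.measurable_survival_comp (by fun_prop) (by fun_prop) (by fun_prop))
      rw [Measure.finsetSum_apply, Finset.sum_range_succ', add_comm, hκ]
      -- The term n = 0 is the unjumped part of `hκ`. The others follow the last-jump recursion,
      -- whose flux the induction hypothesis bounds by that of κ.
      gcongr ?_ + ?_
      · rw [← lintegral_indicator_one hC, pathKernel_apply,
          hq.lintegral_iterKernel_zero _ _ _ hCi, mul_comm]
      · calc ∑ n ∈ Finset.range N, hq.pathKernel (n + 1) u x w C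
            = ∑ n ∈ Finset.range N, ∫⁻ v in Ioo u w, ∫⁻ y, ∫⁻ z,
                C.indicator 1 z * survival q z v w ∂jumpMeasure q y v ∂hq.pathKernel n u x v := by
              refine Finset.sum_congr rfl fun n _ => ?_
              rw [← lintegral_indicator_one hC, hq.lintegral_pathKernel_succ n u x w hCi]
              exact lintegral_congr fun v => hq.lintegral_fluxKernel _ v (hS v)
          _ = ∫⁻ v in Ioo u w, ∫⁻ y, ∫⁻ z, C.indicator 1 z * survival q z v w
                ∂jumpMeasure q y v ∂(∑ n ∈ Finset.range N, hq.pathKernel n u x v) := by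
              rw [← lintegral_finsetSum]
              · exact lintegral_congr fun v => (lintegral_finsetSum_measure _ _ _).symm
              · exact fun n _ => measurable_lintegral_kernel (hq.pathKernel n u x)
                  (g := fun v => v) measurable_id (f := fun v y => ∫⁻ z,
                    C.indicator 1 z * survival q z v w ∂jumpMeasure q y v) hG
          _ ≤ ∫⁻ v in Ioo u w, ∫⁻ y, ∫⁻ z, C.indicator 1 z * survival q z v w
                ∂jumpMeasure q y v ∂κ v :=
              setLIntegral_mono_ae' measurableSet_Ioo (.of_forall fun v hv =>
                lintegral_mono' (ih v ⟨hv.1, (hsub hv).2.le⟩) le_rfl)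
          _ = ∫⁻ v in Ioo u w, ∫⁻ z in C, survival q z v w ∂hq.fluxKernel κ v := by
              refine lintegral_congr fun v => ?_
              rw [← hq.lintegral_fluxKernel κ v (hS v), ← lintegral_indicator hC]
              refine lintegral_congr fun z => ?_
              by_cases hz : z ∈ C <;> simp [hz]
  refine Measure.le_iff.2 fun B hB => ?_
  rw [fellerKernel, Kernel.sum_apply' _ _ hB]
  refine ENNReal.tsum_le_of_sum_range_le fun N => ?_
  have := key N t ⟨hut, le_rfl⟩ B
  rwa [Measure.finsetSum_apply] at this

end IsGlobalQFunction

end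

/-! ### Passage between `[T₀,T₁[` and the whole line -/

section
variable {X : Type*} [MeasurableSpace X]

theorem isMeas_of_forall_eq {f : Set X → ℝ≥0∞} {μ : Measure X}
    (h : ∀ B, MeasurableSet B → f B = μ B) : IsMeas f := by
  refine ⟨by rw [h ∅ .empty, measure_empty], fun A hA hd => ?_⟩
  rw [h _ (.iUnion hA), measure_iUnion hd hA]
  exact tsum_congr fun i => (h _ (hA i)).symm

theorem asMeasure_eq_of_forall_eq {f : Set X → ℝ≥0∞} {μ : Measure X}
    (h : ∀ B, MeasurableSet B → f B = μ B) : asMeasure f = μ :=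
  Measure.ext fun B hB => by rw [asMeasure_apply (isMeas_of_forall_eq h) hB, h B hB]

theorem measurableSet_timeIco (a : ℝ) (T₁ : EReal) : MeasurableSet (timeIco a T₁) :=
  measurableSet_Ici.inter (measurable_coe_real_ereal measurableSet_Iio)

theorem measurableSet_timeIoo (a : ℝ) (T₁ : EReal) : MeasurableSet (timeIoo a T₁) :=
  measurableSet_Ioi.inter (measurable_coe_real_ereal measurableSet_Iio)

theorem mem_timeIco_of_mem_Icc {a u t : ℝ} {T₁ : EReal} (hu : u ∈ timeIco a T₁)
    (ht : t ∈ timeIoo u T₁) {w : ℝ} (hw : w ∈ Icc u t) : w ∈ timeIco a T₁ :=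
  ⟨hu.1.trans hw.1, (EReal.coe_le_coe_iff.2 hw.2).trans_lt ht.2⟩

theorem mem_timeIoo_of_mem_Ioc {u t : ℝ} {T₁ : EReal} (ht : t ∈ timeIoo u T₁) {w : ℝ}
    (hw : w ∈ Ioc u t) : w ∈ timeIoo u T₁ :=
  ⟨hw.1, (EReal.coe_le_coe_iff.2 hw.2).trans_lt ht.2⟩

open Classical in
/-- The Q-function `q`, set to `0` outside `[T₀,T₁[`. -/
def extendZero (T₀ : ℝ) (T₁ : EReal) (q : X → ℝ → SignedMeasure X) : X → ℝ → SignedMeasure X :=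
  fun x t => if t ∈ timeIco T₀ T₁ then q x t else 0

variable {T₀ : ℝ} {T₁ : EReal} {q : X → ℝ → SignedMeasure X}

theorem extendZero_of_mem (x : X) {t : ℝ} (ht : t ∈ timeIco T₀ T₁) :
    extendZero T₀ T₁ q x t = q x t := if_pos ht

theorem extendZero_of_notMem (x : X) {t : ℝ} (ht : t ∉ timeIco T₀ T₁) :
    extendZero T₀ T₁ q x t = 0 := if_neg ht

theorem rate_extendZero (x : X) {t : ℝ} (ht : t ∈ timeIco T₀ T₁) :
    rate (extendZero T₀ T₁ q) x t = rate q x t := by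
  rw [rate, rate, extendZero_of_mem x ht]

theorem jumpMeasure_extendZero (x : X) {t : ℝ} (ht : t ∈ timeIco T₀ T₁) :
    jumpMeasure (extendZero T₀ T₁ q) x t = jumpMeasure q x t := by
  rw [jumpMeasure, jumpMeasure, extendZero_of_mem x ht]

theorem IsQFunction.measurable_extendZero (hq : IsQFunction T₀ T₁ q) {B : Set X}
    (hB : MeasurableSet B) : Measurable fun p : X × ℝ => extendZero T₀ T₁ q p.1 p.2 B := by
  have hs : MeasurableSet (Prod.snd ⁻¹' timeIco T₀ T₁ : Set (X × ℝ)) :=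
    measurable_snd (measurableSet_timeIco T₀ T₁)
  refine measurable_of_restrict_of_restrict_compl hs ?_ ?_
  · have : (Prod.snd ⁻¹' timeIco T₀ T₁ : Set (X × ℝ)).domRestrict
        (fun p : X × ℝ => extendZero T₀ T₁ q p.1 p.2 B) =
        (fun p : X × timeIco T₀ T₁ => q p.1 (p.2 : ℝ) B) ∘ fun p => (p.1.1, ⟨p.1.2, p.2⟩) := by
      ext p
      simp [domRestrict_apply, extendZero_of_mem p.1.1 p.2]
    rw [this]
    exact (hq.measurable B hB).comp ((measurable_fst.comp measurable_subtype_coe).prodMk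
      (Measurable.subtype_mk (measurable_snd.comp measurable_subtype_coe)))
  · have : (Prod.snd ⁻¹' timeIco T₀ T₁ : Set (X × ℝ))ᶜ.domRestrict
        (fun p : X × ℝ => extendZero T₀ T₁ q p.1 p.2 B) = 0 := by
      ext p
      simp [domRestrict_apply, extendZero_of_notMem p.1.1 p.2]
    rw [this]
    exact measurable_const

/-- Extension by zero preserves the signs, measurability and rate bounds, so kernels can be built
over all real times. -/
theorem IsQFunction.isGlobalQFunction (hq : IsQFunction T₀ T₁ q)
    (hLB : ∀ x, rateSup T₀ T₁ q x < ∞) : IsGlobalQFunction (extendZero T₀ T₁ q) where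
  isQFunction T :=
    { total_nonpos := fun x t _ => by
        by_cases ht : t ∈ timeIco T₀ T₁
        · rw [extendZero_of_mem x ht]
          exact hq.total_nonpos x t ht
        · simp [extendZero_of_notMem x ht]
      nonneg := fun x t _ B hB => by
        by_cases ht : t ∈ timeIco T₀ T₁
        · rw [extendZero_of_mem x ht]
          exact hq.nonneg x t ht B hB
        · simp [extendZero_of_notMem x ht]
      measurable := fun B hB => (hq.measurable_extendZero hB).comp
        (measurable_fst.prodMk (measurable_subtype_coe.comp measurable_snd)) }
  measurable _ hB := hq.measurable_extendZero hB
  bounded x := ⟨(rateSup T₀ T₁ q x).toReal, fun t => by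
    by_cases ht : t ∈ timeIco T₀ T₁
    · rw [rate_extendZero x ht]
      refine (ENNReal.ofReal_le_iff_le_toReal (hLB x).ne).1 ?_
      exact le_iSup₂ (f := fun t (_ : t ∈ timeIco T₀ T₁) => ENNReal.ofReal (rate q x t)) t ht
    · simp [rate, extendZero_of_notMem x ht]⟩

theorem survival_extendZero (x : X) {u t : ℝ} (hu : u ∈ timeIco T₀ T₁)
    (ht : t ∈ timeIoo u T₁) : survival (extendZero T₀ T₁ q) x u t = survival q x u t := by
  rw [survival, survival, intervalIntegral.integral_congr fun s hs => ?_]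
  rw [uIcc_of_le ht.1.le] at hs
  exact rate_extendZero x (mem_timeIco_of_mem_Icc hu ht hs)

/-- All times in the recursion lie between u and t, where the extension agrees with q. -/
theorem PbarN_extendZero (n : ℕ) {u : ℝ} (hu : u ∈ timeIco T₀ T₁) (x : X) {t : ℝ}
    (ht : t ∈ timeIoo u T₁) (B : Set X) :
    PbarN (extendZero T₀ T₁ q) n u x t B = PbarN q n u x t B := by
  induction n generalizing u x with
  | zero => rw [PbarN, PbarN, survival_extendZero x hu ht]
  | succ n ih =>
    rw [PbarN, PbarN]
    refine setLIntegral_congr_fun measurableSet_Ioo fun w hw => ?_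
    have hw' := mem_timeIco_of_mem_Icc hu ht ⟨hw.1.le, hw.2.le⟩
    simp only [jumpMeasure_extendZero x hw', ih hw' _ ⟨hw.2, ht.2⟩,
      survival_extendZero x hu (mem_timeIoo_of_mem_Ioc ht ⟨hw.1, hw.2.le⟩)]

theorem Pbar_extendZero {u : ℝ} (hu : u ∈ timeIco T₀ T₁) (x : X) {t : ℝ}
    (ht : t ∈ timeIoo u T₁) (B : Set X) :
    Pbar (extendZero T₀ T₁ q) u x t B = Pbar q u x t B :=
  tsum_congr fun n => PbarN_extendZero n hu x ht B

theorem IsQBounded.mono {A B : Set X} (hB : IsQBounded T₀ T₁ q B) (h : A ⊆ B) :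
    IsQBounded T₀ T₁ q A :=
  have ⟨K, hK⟩ := hB
  ⟨K, fun y hy => hK y (h hy)⟩

/-- The forward equation with the negative term moved to the other side. -/
theorem toReal_eq_indicator_sub_add_iff {α : Type*} {a o i : ℝ≥0∞} (ha : a ≠ ∞)
    (ho : o ≠ ∞) (hi : i ≠ ∞)
    (B : Set α) (x : α) :
    a.toReal = B.indicator (fun _ => (1 : ℝ)) x - o.toReal + i.toReal ↔
      a + o = B.indicator 1 x + i := by
  have h1 : (B.indicator (1 : α → ℝ≥0∞) x) ≠ ∞ := by by_cases h : x ∈ B <;> simp [h]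
  have h2 : (B.indicator (1 : α → ℝ≥0∞) x).toReal = B.indicator (fun _ => (1 : ℝ)) x := by
    by_cases h : x ∈ B <;> simp [h]
  rw [← ENNReal.toReal_eq_toReal_iff' (ENNReal.add_ne_top.2 ⟨ha, ho⟩)
    (ENNReal.add_ne_top.2 ⟨h1, hi⟩), ENNReal.toReal_add ha ho, ENNReal.toReal_add h1 hi, h2]
  constructor <;> intro h <;> linarith

theorem outflow_eq {P : ℝ → X → ℝ → Set X → ℝ≥0∞} {u : ℝ} (hu : u ∈ timeIco T₀ T₁) (x : X)
    {t : ℝ} (ht : t ∈ timeIoo u T₁) {κ : ℝ → Measure X}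
    (hκ : ∀ w ∈ Ioo u t, asMeasure (P u x w) = κ w) (B : Set X) :
    outflow q P u x t B =
      ∫⁻ w in Ioo u t, ∫⁻ y in B, ENNReal.ofReal (rate (extendZero T₀ T₁ q) y w) ∂κ w := by
  refine setLIntegral_congr_fun measurableSet_Ioo fun w hw => ?_
  simp only [hκ w hw, rate_extendZero _ (mem_timeIco_of_mem_Icc hu ht ⟨hw.1.le, hw.2.le⟩)]

theorem inflow_eq {P : ℝ → X → ℝ → Set X → ℝ≥0∞} {u : ℝ} (hu : u ∈ timeIco T₀ T₁) (x : X)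
    {t : ℝ} (ht : t ∈ timeIoo u T₁) {κ : ℝ → Measure X}
    (hκ : ∀ w ∈ Ioo u t, asMeasure (P u x w) = κ w) (B : Set X) :
    inflow q P u x t B =
      ∫⁻ w in Ioo u t, ∫⁻ y, ENNReal.ofReal (extendZero T₀ T₁ q y w (B \ {y})) ∂κ w := by
  refine setLIntegral_congr_fun measurableSet_Ioo fun w hw => ?_
  simp only [hκ w hw, extendZero_of_mem _ (mem_timeIco_of_mem_Icc hu ht ⟨hw.1.le, hw.2.le⟩)]

open Classical in
/-- A function of the class `P̂`, with `u` and `x` fixed, as a kernel in `t`. -/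
def MemPHat.kernel {P : ℝ → X → ℝ → Set X → ℝ≥0∞} (hP : MemPHat T₀ T₁ P) {u : ℝ}
    (hu : u ∈ timeIco T₀ T₁) (x : X) : Kernel ℝ X where
  toFun w := if w ∈ timeIoo u T₁ then asMeasure (P u x w) else 0
  measurable' := Measure.measurable_of_measurable_coe _ fun B hB => by
    refine measurable_of_restrict_of_restrict_compl (measurableSet_timeIoo u T₁) ?_ ?_
    · convert hP.measurable u hu x B hB using 1
      ext w
      simp [domRestrict_apply, w.2, asMeasure_apply (hP.isMeas u hu x w w.2) hB]
    · convert measurable_const (a := (0 : ℝ≥0∞)) using 1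
      ext w
      have : (w : ℝ) ∉ timeIoo u T₁ := w.2
      simp [domRestrict_apply, this]

theorem MemPHat.kernel_of_mem {P : ℝ → X → ℝ → Set X → ℝ≥0∞} (hP : MemPHat T₀ T₁ P) {u : ℝ}
    (hu : u ∈ timeIco T₀ T₁) (x : X) {w : ℝ} (hw : w ∈ timeIoo u T₁) :
    hP.kernel hu x w = asMeasure (P u x w) := if_pos hw

theorem MemPHat.kernel_apply {P : ℝ → X → ℝ → Set X → ℝ≥0∞} (hP : MemPHat T₀ T₁ P) {u : ℝ}
    (hu : u ∈ timeIco T₀ T₁) (x : X) {w : ℝ} (hw : w ∈ timeIoo u T₁) {B : Set X}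
    (hB : MeasurableSet B) : hP.kernel hu x w B = P u x w B := by
  rw [hP.kernel_of_mem hu x hw, asMeasure_apply (hP.isMeas u hu x w hw) hB]

instance MemPHat.isSFiniteKernel_kernel {P : ℝ → X → ℝ → Set X → ℝ≥0∞} (hP : MemPHat T₀ T₁ P)
    {u : ℝ} (hu : u ∈ timeIco T₀ T₁) (x : X) : IsSFiniteKernel (hP.kernel hu x) :=
  isSFiniteKernel_of_forall_isFiniteMeasure _ fun w => ⟨by
    by_cases hw : w ∈ timeIoo u T₁
    · rw [hP.kernel_apply hu x hw .univ]
      exact hP.finite u hu x w hw univ .univ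
    · have : hP.kernel hu x w = 0 := if_neg hw
      simp [this]⟩

variable [StandardBorelSpace X]

/-- Although the supremum of the jump rates over time need not be measurable, the state space is a
countable union of measurable `q`-bounded sets. -/
theorem exists_monotone_isQBounded (hq : IsQFunction T₀ T₁ q)
    (hLB : ∀ x, rateSup T₀ T₁ q x < ∞) :
    ∃ D : ℕ → Set X, Monotone D ∧ (∀ k, MeasurableSet (D k)) ∧ ⋃ k, D k = univ ∧
      ∀ k, IsQBounded T₀ T₁ q (D k) := by
  have hg := hq.isGlobalQFunction hLB
  -- The projection of `E n` to X is where the supremum of the rate over time exceeds n: an analytic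
  -- set, not necessarily Borel.
  let E : ℕ → Set (X × ℝ) := fun n => {p | (n : ℝ) < rate (extendZero T₀ T₁ q) p.1 p.2}
  have hE : ∀ n, MeasurableSet (E n) := fun n => measurableSet_lt measurable_const hg.measurable_rate
  let := upgradeStandardBorel X
  obtain ⟨B, hBm, hB, hBe⟩ := measurablySeparableSeq_of_analyticSet
    (A := fun n => Prod.fst '' E n) (fun n => (hE n).analyticSet_image measurable_fst) (by
      refine eq_empty_of_forall_notMem fun x hx => ?_
      obtain ⟨K, hK⟩ := hg.bounded x
      obtain ⟨n, hn⟩ := exists_nat_gt K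
      obtain ⟨⟨y, t⟩, hp, rfl⟩ := mem_iInter.1 hx n
      exact (hn.trans hp).not_ge (hK t))
  -- Off `B i` the rate is at most i at all times, so k bounds it on the union over i ≤ k. These
  -- unions exhaust X because the `B i` have empty intersection.
  refine ⟨fun k => ⋃ i ≤ k, (B i)ᶜ, fun k l hkl => ?_, fun k => ?_, ?_, fun k => ⟨k, ?_⟩⟩
  · exact biUnion_subset_biUnion_left fun i hi => le_trans hi hkl
  · exact .biUnion (to_countable _) fun i _ => (hBm i).compl
  · refine eq_univ_of_forall fun x => ?_
    have : x ∉ ⋂ n, B n := by simp [hBe]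
    obtain ⟨n, hn⟩ := not_forall.1 (mt mem_iInter.2 this)
    exact mem_iUnion.2 ⟨n, mem_biUnion (le_refl n) hn⟩
  · intro y hy t ht
    obtain ⟨i, hi, hyi⟩ := mem_iUnion₂.1 hy
    rw [← rate_extendZero y ht]
    by_contra! hlt
    exact hyi (hB i ⟨(y, t), (Nat.cast_le.2 hi).trans_lt hlt, rfl⟩)

/-! ### Forward equation, minimality and uniqueness on `[T₀,T₁[` -/

section Feller

variable (hq : IsQFunction T₀ T₁ q) (hLB : ∀ x, rateSup T₀ T₁ q x < ∞)

include hq hLB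

theorem fellerKernel_apply_eq_Pbar {u : ℝ} (hu : u ∈ timeIco T₀ T₁) (x : X) {t : ℝ}
    (ht : t ∈ timeIoo u T₁) {B : Set X} (hB : MeasurableSet B) :
    Pbar q u x t B = (hq.isGlobalQFunction hLB).fellerKernel (u, x, t) B := by
  rw [IsGlobalQFunction.fellerKernel_apply _ _ _ _ hB, Pbar_extendZero hu x ht]

theorem valuesLeOne_Pbar : ValuesLeOne T₀ T₁ (Pbar q) := fun u hu x t ht B hB => by
  rw [fellerKernel_apply_eq_Pbar hq hLB hu x ht hB]
  exact (measure_mono (subset_univ B)).trans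
    ((hq.isGlobalQFunction hLB).fellerKernel_univ_le_one x ht.1.le)

theorem memPHat_Pbar : MemPHat T₀ T₁ (Pbar q) where
  isMeas _ hu x _ ht := isMeas_of_forall_eq fun _ hB => fellerKernel_apply_eq_Pbar hq hLB hu x ht hB
  finite u hu x t ht B hB := (valuesLeOne_Pbar hq hLB u hu x t ht B hB).trans_lt ENNReal.one_lt_top
  measurable u hu x B hB := by
    have : (fun t : timeIoo u T₁ => Pbar q u x (t : ℝ) B) = fun t : timeIoo u T₁ =>
        (hq.isGlobalQFunction hLB).fellerKernel (u, x, (t : ℝ)) B :=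
      funext fun t => fellerKernel_apply_eq_Pbar hq hLB hu x t.2 hB
    rw [this]
    exact (Kernel.measurable_coe _ hB).comp (by fun_prop)

/-- The q-bound K on B and total mass at most 1 make the outflow finite; the identity in `[0,∞]`
then forces the inflow to be finite. -/
theorem satisfiesFKE_Pbar : SatisfiesFKE T₀ T₁ q (Pbar q) := by
  intro u hu x B hB ⟨K, hK⟩ t ht
  have hg := hq.isGlobalQFunction hLB
  have hκ : ∀ w ∈ Ioo u t, asMeasure (Pbar q u x w) = hg.fellerKernel (u, x, w) := fun w hw =>
    asMeasure_eq_of_forall_eq fun C hC =>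
      fellerKernel_apply_eq_Pbar hq hLB hu x (mem_timeIoo_of_mem_Ioc ht ⟨hw.1, hw.2.le⟩) hC
  have hout : outflow q (Pbar q) u x t B < ∞ := by
    rw [outflow_eq hu x ht hκ]
    calc _ ≤ ∫⁻ _ in Ioo u t, ENNReal.ofReal K := by
          refine setLIntegral_mono_ae' measurableSet_Ioo (.of_forall fun w hw => ?_)
          calc _ ≤ ∫⁻ _ in B, ENNReal.ofReal K ∂hg.fellerKernel (u, x, w) := by
                refine setLIntegral_mono_ae' hB (.of_forall fun y hy => ?_)
                have hw' := mem_timeIco_of_mem_Icc hu ht ⟨hw.1.le, hw.2.le⟩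
                rw [rate_extendZero y hw']
                exact ENNReal.ofReal_le_ofReal (hK y hy w hw')
            _ ≤ ENNReal.ofReal K * 1 := by
                rw [setLIntegral_const]
                gcongr
                exact (measure_mono (subset_univ B)).trans (hg.fellerKernel_univ_le_one x hw.1.le)
            _ = _ := mul_one _
      _ < ∞ := by simp [ENNReal.mul_lt_top]
  have hfin := ((memPHat_Pbar hq hLB).finite u hu x t ht B hB).ne
  have key : Pbar q u x t B + outflow q (Pbar q) u x t B =
      B.indicator 1 x + inflow q (Pbar q) u x t B := by
    have := hg.fellerKernel_forward x ht.1.le (f := B.indicator 1) (measurable_one.indicator hB)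
    rw [lintegral_indicator_one hB, ← fellerKernel_apply_eq_Pbar hq hLB hu x ht hB] at this
    rw [outflow_eq hu x ht hκ, inflow_eq hu x ht hκ]
    convert this using 4 with w w
    · rw [← lintegral_indicator hB]
      refine lintegral_congr fun y => ?_
      by_cases hy : y ∈ B <;> simp [hy]
    · refine lintegral_congr fun y => ?_
      rw [lintegral_indicator_one hB, hg.jumpMeasure_apply _ _ hB]
  have hin : inflow q (Pbar q) u x t B < ∞ :=
    (le_add_self.trans key.ge).trans_lt (ENNReal.add_lt_top.2 ⟨hfin.lt_top, hout⟩)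
  exact ⟨hout, hin, (toReal_eq_indicator_sub_add_iff hfin hout.ne hin.ne B x).2 key⟩

/-- Subsets of q-bounded sets are q-bounded, so the equation holds on every subset of `D k`; its
finiteness clause on `D k` supplies the integrability for variation of constants. -/
theorem Pbar_le_of_satisfiesFKE {P : ℝ → X → ℝ → Set X → ℝ≥0∞} (hP : MemPHat T₀ T₁ P)
    (hPE : SatisfiesFKE T₀ T₁ q P) {u : ℝ} (hu : u ∈ timeIco T₀ T₁) (x : X) {t : ℝ}
    (ht : t ∈ timeIoo u T₁) {B : Set X} (hB : MeasurableSet B) :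
    Pbar q u x t B ≤ P u x t B := by
  have hg := hq.isGlobalQFunction hLB
  obtain ⟨D, hD, hDm, hDu, hDb⟩ := exists_monotone_isQBounded hq hLB
  have hκ : ∀ w ∈ timeIoo u T₁, ∀ v ∈ Ioo u w, asMeasure (P u x v) = hP.kernel hu x v :=
    fun w hw v hv => (hP.kernel_of_mem hu x (mem_timeIoo_of_mem_Ioc hw ⟨hv.1, hv.2.le⟩)).symm
  rw [fellerKernel_apply_eq_Pbar hq hLB hu x ht hB, ← hP.kernel_apply hu x ht hB]
  refine hg.fellerKernel_le (hP.kernel hu x) x hD hDm hDu (fun k w hw C hC hCm => ?_) (fun k => ?_)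
    ht.1 B
  · have hw' := mem_timeIoo_of_mem_Ioc ht hw
    obtain ⟨ho, hi, he⟩ := hPE u hu x C hCm ((hDb k).mono hC) w hw'
    rw [toReal_eq_indicator_sub_add_iff (hP.finite u hu x w hw' C hCm).ne ho.ne hi.ne,
      outflow_eq hu x hw' (hκ w hw'), inflow_eq hu x hw' (hκ w hw')] at he
    rw [hP.kernel_apply hu x hw' hCm, he]
    simp_rw [hg.fluxKernel_apply (hP.kernel hu x) _ hCm]
  · rw [← outflow_eq hu x ht (hκ t ht)]
    exact (hPE u hu x (D k) (hDm k) (hDb k) t ht).1.ne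

/-- P dominates P̄ on B and on its complement, while its total mass is at most 1, the total mass of
P̄; hence no excess on B is possible. -/
theorem eq_Pbar_of_isRegular (hreg : IsRegular T₀ T₁ (Pbar q))
    {P : ℝ → X → ℝ → Set X → ℝ≥0∞} (hP : MemPHat T₀ T₁ P) (hP1 : ValuesLeOne T₀ T₁ P)
    (hPE : SatisfiesFKE T₀ T₁ q P) {u : ℝ} (hu : u ∈ timeIco T₀ T₁) (x : X) {t : ℝ}
    (ht : t ∈ timeIoo u T₁) {B : Set X} (hB : MeasurableSet B) :
    P u x t B = Pbar q u x t B := by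
  have hle := fun {C : Set X} (hC : MeasurableSet C) =>
    Pbar_le_of_satisfiesFKE hq hLB hP hPE hu x ht hC
  have hM := memPHat_Pbar hq hLB
  have hsum : P u x t B + P u x t Bᶜ ≤ Pbar q u x t B + Pbar q u x t Bᶜ := by
    rw [← hP.kernel_apply hu x ht hB, ← hP.kernel_apply hu x ht hB.compl,
      ← hM.kernel_apply hu x ht hB, ← hM.kernel_apply hu x ht hB.compl, measure_add_measure_compl hB,
      measure_add_measure_compl hB, hP.kernel_apply hu x ht .univ, hM.kernel_apply hu x ht .univ,
      hreg u hu x t ht]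
    exact hP1 u hu x t ht univ .univ
  refine le_antisymm ?_ (hle hB)
  refine (ENNReal.add_le_add_iff_right (hM.finite u hu x t ht _ hB.compl).ne).1 ?_
  exact (add_le_add_right (hle hB.compl) _).trans hsum

end Feller

end

end JumpMarkov

end

theorem corollary3p1 {X : Type*} [MeasurableSpace X] [StandardBorelSpace X]
    (T₀ : ℝ) (T₁ : EReal) (hT : (T₀ : EReal) < T₁)
    (q : X → ℝ → SignedMeasure X)
    (hq : JumpMarkov.IsQFunction T₀ T₁ q) (hcons : JumpMarkov.IsConservative T₀ T₁ q)
    (hLB : ∀ x, JumpMarkov.rateSup T₀ T₁ q x < ∞) :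
    JumpMarkov.SatisfiesFKE T₀ T₁ q (JumpMarkov.Pbar q) ∧
    (JumpMarkov.MemPHat T₀ T₁ (JumpMarkov.Pbar q) ∧
      ∀ P : ℝ → X → ℝ → Set X → ℝ≥0∞,
        JumpMarkov.MemPHat T₀ T₁ P → JumpMarkov.SatisfiesFKE T₀ T₁ q P →
        ∀ u ∈ JumpMarkov.timeIco T₀ T₁, ∀ x, ∀ t ∈ JumpMarkov.timeIoo u T₁,
          ∀ B, MeasurableSet B → JumpMarkov.Pbar q u x t B ≤ P u x t B) ∧
    (JumpMarkov.IsRegular T₀ T₁ (JumpMarkov.Pbar q) →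
      JumpMarkov.ValuesLeOne T₀ T₁ (JumpMarkov.Pbar q) ∧
      ∀ P : ℝ → X → ℝ → Set X → ℝ≥0∞,
        JumpMarkov.MemPHat T₀ T₁ P → JumpMarkov.ValuesLeOne T₀ T₁ P →
        JumpMarkov.SatisfiesFKE T₀ T₁ q P →
        ∀ u ∈ JumpMarkov.timeIco T₀ T₁, ∀ x, ∀ t ∈ JumpMarkov.timeIoo u T₁,
          ∀ B, MeasurableSet B → P u x t B = JumpMarkov.Pbar q u x t B) := by
  refine ⟨JumpMarkov.satisfiesFKE_Pbar hq hLB, ⟨JumpMarkov.memPHat_Pbar hq hLB, ?_⟩, ?_⟩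
  · exact fun P hP hPE u hu x t ht B hB =>
      JumpMarkov.Pbar_le_of_satisfiesFKE hq hLB hP hPE hu x ht hB
  · exact fun hreg => ⟨JumpMarkov.valuesLeOne_Pbar hq hLB, fun P hP hP1 hPE u hu x t ht B hB =>
      JumpMarkov.eq_Pbar_of_isRegular hq hLB hreg hP hP1 hPE hu x ht hB⟩
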